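/- Write $e(x) = e^{2\pi i x}$ for real $x$, and let $\log$ denote the logarithm to base $2$. There is an absolute constant $C > 0$ such that for every prime $p$, every integer $a \not\equiv 0 \pmod p$ and all positive integers $M, N$ with $N \le p$, $$\left| \sum_{n=M}^{M+N} e\left( \frac{a n^p}{p^2} \right) \right| \le C\, p^{21/34}\, N^{1/4}\, (\log p)^{5/34} .$$ In particular, there is an absolute constant $C' > 0$ such that for every prime $p$ and every integer $a \not\equiv 0 \pmod p$ the Heilbronn sum $S(a) = \sum_{n=1}^{p} e\left( \frac{a n^p}{p^2} \right)$ satisfies $$|S(a)| \le C'\, p^{59/68}\, (\log p)^{5/34} .$$ -/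

import Mathlib

/-- The additive exponential `e(x) = exp(2 π i x)` of a real number `x`. -/
noncomputable def addExp (x : ℝ) : ℂ :=
  Complex.exp (2 * (Real.pi : ℂ) * Complex.I * (x : ℂ))

/-- The incomplete Heilbronn sum `∑ e(a n ^ p / p ^ 2)`, over all integers `n` with
`M ≤ n ≤ M + N` (both ends included). -/
noncomputable def incompleteHeilbronnSum (p : ℕ) (a : ℤ) (M N : ℕ) : ℂ :=
  ∑ n ∈ Finset.Icc M (M + N), addExp ((a : ℝ) * (n : ℝ) ^ p / (p : ℝ) ^ 2)

/-- Heilbronn's exponential sum `S(a) = ∑ e(a n ^ p / p ^ 2)`, over `1 ≤ n ≤ p`. -/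
noncomputable def heilbronnSum (p : ℕ) (a : ℤ) : ℂ :=
  ∑ n ∈ Finset.Icc 1 p, addExp ((a : ℝ) * (n : ℝ) ^ p / (p : ℝ) ^ 2)

/-!
The Heilbronn sum is an exponential sum over the group `Γ` of those units modulo `p ^ 2` that are
`p`-th powers, and it is bounded through the additive energy `E` of `Γ`, for which
`E ≪ p ^ (42/17) (log p) ^ (10/17)`.

*From the energy to the sums.* By orthogonality the fourth moment of the sums `S(z)` over
`z mod p ^ 2` is `p ^ 2 E`. Since `S` is constant on the cosets of `Γ`, and the `a + p b` with
`b mod p` represent all cosets of units, `∑_b |S(a + p b)| ^ 4 ≪ p E`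
(`sum_norm_powSum_pow_four_le`). As `n ^ p ≡ n mod p`, completing an incomplete sum introduces
exactly these frequencies, and Hölder's inequality with exponents `4/3` and `4` bounds it by
`(N E) ^ (1/4)` (`exists_norm_sum_stdAddChar_le`).

*Representations as differences.* A unit modulo `p ^ 2` lies in one of `p` cosets of `Γ`, labelled
by `r mod p`, and the number of its representations as a difference of two elements of `Γ` is the
number `N_r` (`logCount`) of solutions of `f(k) = r` with `k ≠ 0, 1`, where `f` is the truncated
logarithm `X + X ^ 2 / 2 + ⋯ + X ^ (p - 1) / (p - 1)` (`autocorr_powInd_unitOf`). Stepanov's method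
gives `#{r : N_r ≥ t} ≪ p ^ 2 / t ^ 3` (`pow_three_mul_card_le`). The auxiliary polynomial is a
combination of `(1 - X) ^ a f ^ b X ^ (p c)`; it does not vanish identically because `f` satisfies
no algebraic relation of low degree modulo `X ^ p` (`eq_zero_of_X_pow_dvd_sum_comp_truncLog`).
Consequently `Z = ∑ N_r ^ 3 ≪ p ^ 2 log p` and `Y = ∑ N_r ^ 2 ≪ p ^ (3/2)`, while
`E` is at most `p ^ 2 + p Y`.

*The energy.* Let `g` be the autocorrelation of `Γ` and `w` its restriction to the units with
`g ≤ τ₁ ≍ p ^ 2 / Y`, which keeps half of `Y`. The matrix `g(y - y')`, with `y, y' ∈ Γ`, is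
positive semidefinite, and the constant vector is an eigenvector of the matrix `w(x - y)`; this
bounds `Y ^ 3`, up to a constant, by the sum of `w(x - y) w(x - y') g(y - y')` over triples from `Γ`. The
values of `g` above a second level `τ ≍ p ^ 5 log p / Y ^ 3` contribute little to it
(`sq_mul_energy_le`). The rest is handled by the Cauchy–Schwarz inequality, which leaves `∑ g ^ 3`
and a sum of `w(α) ^ 2 w(β) ^ 2 v(β - α) ^ 2`, where `v` is `g` cut off at `τ`. In coset
coordinates the latter is a weighted count of incidences `f(k) + k r' - (k - 1) r = s`, bounded in
`sum_incidence_le` because two distinct pairs `(r, r')` are compatible for at most one `k`. With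
these `τ₁` and `τ` the result is `Y ^ 17 ≪ p ^ 25 (log p) ^ 10` (`pow_seventeen_le_of_energy`).
-/

/-! ### The truncated logarithm -/

open Polynomial in
/-- The truncated logarithm `∑_{1 ≤ j < p} X ^ j / j` over `ZMod p`, that is `-log (1 - X)` cut off
below degree `p`. -/
noncomputable def truncLog (p : ℕ) : (ZMod p)[X] :=
  ∑ j ∈ Finset.Ico 1 p, C ((j : ZMod p)⁻¹) * X ^ j

open Polynomial in
lemma natDegree_truncLog_le (p : ℕ) : (truncLog p).natDegree ≤ p - 1 := by
  refine natDegree_sum_le_of_forall_le _ _ fun j hj => ?_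
  exact (natDegree_C_mul_X_pow_le _ _).trans (by have := Finset.mem_Ico.1 hj; omega)

section Stepanov

open Polynomial Finset

variable {p : ℕ} [Fact p.Prime]

lemma natCast_ne_zero_of_pos_of_lt {j : ℕ} (h0 : 0 < j) (h1 : j < p) : (j : ZMod p) ≠ 0 := by
  rw [Ne, ZMod.natCast_eq_zero_iff]
  exact fun h => absurd (Nat.le_of_dvd h0 h) (by omega)

lemma natCast_injOn_lt {i j : ℕ} (hi : i < p) (hj : j < p) (h : (i : ZMod p) = j) : i = j := by
  rw [ZMod.natCast_eq_natCast_iff] at h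
  exact Nat.ModEq.eq_of_lt_of_lt h hi hj

lemma derivative_truncLog : derivative (truncLog p) = ∑ j ∈ range (p - 1), X ^ j := by
  have hp := (Fact.out : p.Prime).two_le
  rw [truncLog, derivative_sum, Finset.sum_Ico_eq_sum_range]
  refine Finset.sum_congr rfl fun j hj => ?_
  have hj' := mem_range.1 hj
  have : ((1 + j : ℕ) : ZMod p) ≠ 0 := natCast_ne_zero_of_pos_of_lt (by omega) (by omega)
  rw [derivative_C_mul_X_pow, inv_mul_cancel₀ this]
  simp

lemma one_sub_X_mul_derivative_truncLog :
    (1 - X) * derivative (truncLog p) = 1 - X ^ (p - 1) := by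
  rw [derivative_truncLog]; exact mul_neg_geom_sum X (p - 1)

lemma X_mul_one_sub_X_mul_derivative_truncLog :
    X * (1 - X) * derivative (truncLog p) = X - X ^ p := by
  have hp := (Fact.out : p.Prime).two_le
  rw [mul_assoc, one_sub_X_mul_derivative_truncLog, mul_sub, mul_one, ← pow_succ',
    Nat.sub_add_cancel (by omega)]

/-! ### Algebraic independence of `X` and the truncated logarithm at low degree -/

open scoped Classical in
/-- The number of coefficients of a polynomial up to its leading one; `0` for the zero
polynomial. -/
noncomputable def coeffCount {K : Type*} [Field K] (c : K[X]) : ℕ :=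
  if c = 0 then 0 else c.natDegree + 1

lemma natDegree_lt_of_coeffCount_le {c : (ZMod p)[X]} {m : ℕ} (h : coeffCount c ≤ m)
    (hm : 0 < m) : c.natDegree < m := by
  unfold coeffCount at h
  split_ifs at h with h0
  · simpa [h0]
  · omega

lemma coeffCount_eq_zero {K : Type*} [Field K] {c : K[X]} : coeffCount c = 0 ↔ c = 0 := by
  unfold coeffCount; split_ifs with h <;> simp [h]

lemma coeffCount_C_mul_add_derivative_le (a : ZMod p) (c : (ZMod p)[X]) :
    coeffCount (C a * c + derivative c) ≤ coeffCount c := by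
  unfold coeffCount
  by_cases h : c = 0
  · simp [h]
  · have : (C a * c + derivative c).natDegree ≤ c.natDegree :=
      (natDegree_add_le _ _).trans (max_le (natDegree_C_mul_le _ _)
        ((natDegree_derivative_le _).trans (Nat.sub_le _ _)))
    simp only [h, if_false]
    split_ifs <;> omega

lemma coeffCount_derivative_lt {c : (ZMod p)[X]} (h : c ≠ 0) :
    coeffCount (derivative c) < coeffCount c := by
  unfold coeffCount
  simp only [h, if_false]
  split_ifs with h'
  · omega
  · by_cases h0 : c.natDegree = 0
    · exact absurd (derivative_of_natDegree_zero h0) h'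
    · have := natDegree_derivative_le c
      omega

/-- If `X ^ m` divides `∑_j (1 - X) ^ j * c_j(f)`, where `f` is the truncated logarithm and the
`c_j` have at most `m ≤ p` coefficients in total, then all `c_j` vanish. The operator
`i + (1 - X) d/dX` lowers the order of vanishing by one and, up to terms of order `p - 1`, acts on
the coefficients as `c_j ↦ (i - j) c_j + c_j'`, which lowers the degree of `c_i`. -/
lemma eq_zero_of_X_pow_dvd_sum_comp_truncLog {A : ℕ} (hA : A ≤ p) :
    ∀ (m : ℕ) (c : ℕ → (ZMod p)[X]), m ≤ p → ∑ j ∈ range A, coeffCount (c j) ≤ m →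
      (X : (ZMod p)[X]) ^ m ∣ ∑ j ∈ range A, (1 - X) ^ j * (c j).comp (truncLog p) →
      ∀ j ∈ range A, c j = 0 := by
  intro m
  induction m with
  | zero =>
    intro c _ hs _ j hj
    have := (Finset.sum_eq_zero_iff.1 (Nat.le_zero.1 hs)) j hj
    exact coeffCount_eq_zero.1 this
  | succ m ih =>
    intro c hm hs hd
    by_contra! hne
    obtain ⟨i, hi, hci⟩ := hne
    have hp := (Fact.out : p.Prime).two_le
    -- the transformed coefficients
    set d : ℕ → (ZMod p)[X] := fun j => C ((i : ZMod p) - j) * c j + derivative (c j) with hdd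
    have hdi : d i = derivative (c i) := by simp [hdd]
    have hsum : ∑ j ∈ range A, coeffCount (d j) ≤ m := by
      have : ∑ j ∈ range A, coeffCount (d j) < ∑ j ∈ range A, coeffCount (c j) := by
        refine Finset.sum_lt_sum (fun j _ => coeffCount_C_mul_add_derivative_le _ _) ⟨i, hi, ?_⟩
        rw [hdi]; exact coeffCount_derivative_lt hci
      omega
    have hdvd : (X : (ZMod p)[X]) ^ m ∣
        ∑ j ∈ range A, (1 - X) ^ j * (d j).comp (truncLog p) := by
      have key : ∑ j ∈ range A, (1 - X) ^ j * (d j).comp (truncLog p) =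
          C (i : ZMod p) * (∑ j ∈ range A, (1 - X) ^ j * (c j).comp (truncLog p)) +
          (1 - X) * derivative (∑ j ∈ range A, (1 - X) ^ j * (c j).comp (truncLog p)) +
          X ^ (p - 1) * ∑ j ∈ range A, (1 - X) ^ j * (derivative (c j)).comp (truncLog p) := by
        rw [derivative_sum, Finset.mul_sum, Finset.mul_sum, Finset.mul_sum,
          ← Finset.sum_add_distrib, ← Finset.sum_add_distrib]
        refine Finset.sum_congr rfl fun j _ => ?_
        have h1 : (1 - X : (ZMod p)[X]) * derivative ((1 - X) ^ j) = - C (j : ZMod p) * (1 - X) ^ j := by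
          rw [derivative_pow]
          rcases j with _ | j
          · simp
          · simp [pow_succ]; ring
        have h2 := one_sub_X_mul_derivative_truncLog (p := p)
        rw [derivative_mul, derivative_comp]
        simp only [hdd, add_comp, mul_comp, C_comp, C_sub, sub_comp]
        linear_combination (-(c j).comp (truncLog p)) * h1 -
          (1 - X) ^ j * (derivative (c j)).comp (truncLog p) * h2
      rw [key]
      refine dvd_add (dvd_add ?_ ?_) ?_
      · exact ((pow_dvd_pow _ (Nat.le_succ m)).trans hd).mul_left _
      · refine Dvd.dvd.mul_left ?_ _
        obtain ⟨q, hq⟩ := hd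
        rw [hq, derivative_mul, derivative_X_pow, Nat.add_sub_cancel]
        exact dvd_add (((dvd_refl _).mul_left _).mul_right _)
          ((pow_dvd_pow _ (Nat.le_succ m)).mul_right _)
      · exact (pow_dvd_pow _ (by omega)).mul_right _
    have hd0 := ih d (by omega) hsum hdvd
    have hdeg : ∀ j ∈ range A, (c j).natDegree < p := fun j hj => by
      refine natDegree_lt_of_coeffCount_le (m := p) ?_ (by omega)
      exact ((Finset.single_le_sum (f := fun j => coeffCount (c j)) (fun _ _ => Nat.zero_le _)
        hj).trans hs).trans hm
    -- all coefficients other than the `i`-th vanish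
    have hother : ∀ j ∈ range A, j ≠ i → c j = 0 := by
      intro j hj hji
      by_contra hc
      have h0 : C ((i : ZMod p) - j) * c j = -derivative (c j) :=
        eq_neg_of_add_eq_zero_left (hd0 j hj)
      have hij : (i : ZMod p) - j ≠ 0 := fun h => hji (natCast_injOn_lt
        ((mem_range.1 hj).trans_le hA) ((mem_range.1 hi).trans_le hA) (sub_eq_zero.1 h).symm)
      have hlt := degree_derivative_lt hc
      rw [← degree_neg, ← h0, degree_C_mul hij] at hlt
      exact lt_irrefl _ hlt
    have hci' : derivative (c i) = 0 := by rw [← hdi]; exact hd0 i hi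
    have hc0 : (c i).natDegree = 0 := by
      by_contra hne
      have h1 := congrArg (fun q => coeff q ((c i).natDegree - 1)) hci'
      simp only [coeff_derivative, coeff_zero] at h1
      have h2 : (((c i).natDegree - 1 : ℕ) : ZMod p) + 1 = ((c i).natDegree : ℕ) := by
        rw [← Nat.cast_succ]; congr 1; omega
      rw [h2, show (c i).natDegree - 1 + 1 = (c i).natDegree by omega] at h1
      rcases mul_eq_zero.1 h1 with h | h
      · exact hci (leadingCoeff_eq_zero.1 h)
      · exact natCast_ne_zero_of_pos_of_lt (by omega) (hdeg i hi) h
    rw [Finset.sum_eq_single_of_mem i hi (fun j hj hji => by rw [hother j hj hji]; simp)] at hd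
    have hX : (X : (ZMod p)[X]) ∣ (1 - X) ^ i * (c i).comp (truncLog p) :=
      (dvd_pow_self X (Nat.succ_ne_zero m)).trans hd
    rw [X_dvd_iff, coeff_zero_eq_eval_zero, eq_C_of_natDegree_eq_zero hc0] at hX
    simp at hX
    apply hci
    rw [eq_C_of_natDegree_eq_zero hc0, hX, C_0]

/-! ### Vanishing to high order -/

/-- The derivation `X (1 - X) d/dX`. -/
noncomputable def thetaDeriv : Module.End (ZMod p) (ZMod p)[X] :=
  LinearMap.mulLeft (ZMod p) (X * (1 - X)) ∘ₗ derivative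

lemma thetaDeriv_apply (q : (ZMod p)[X]) : thetaDeriv q = X * (1 - X) * derivative q := rfl

lemma eval_thetaDeriv_iterate_X_sub_C_pow_mul (k : ZMod p) (m : ℕ) (q : (ZMod p)[X]) :
    ((thetaDeriv ^ m) ((X - C k) ^ m * q)).eval k = m.factorial * (k * (1 - k)) ^ m * q.eval k := by
  induction m generalizing q with
  | zero => simp
  | succ m ih =>
    have : thetaDeriv ((X - C k) ^ (m + 1) * q) = (X - C k) ^ m *
        (C ((m : ZMod p) + 1) * (X * (1 - X)) * q + (X - C k) * (X * (1 - X) * derivative q)) := by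
      rw [thetaDeriv_apply, derivative_mul, derivative_X_sub_C_pow, Nat.add_sub_cancel]
      simp only [Nat.cast_add, Nat.cast_one, C_add, C_1]
      simp
      ring
    rw [pow_succ, Module.End.mul_apply, this, ih]
    simp [Nat.factorial_succ]
    ring

/-- Vanishing of the first `D ≤ p` iterates of `X (1 - X) d/dX` detects zeros of order `D`, since
`m!` is invertible for `m < p`. -/
lemma X_sub_C_pow_dvd_of_eval_thetaDeriv_eq_zero {k : ZMod p} (h0 : k ≠ 0) (h1 : k ≠ 1)
    {q : (ZMod p)[X]} :
    ∀ {D : ℕ}, D ≤ p → (∀ n < D, ((thetaDeriv ^ n) q).eval k = 0) → (X - C k) ^ D ∣ q := by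
  intro D
  induction D with
  | zero => intro _ _; simp
  | succ D ih =>
    intro hD h
    obtain ⟨r, hr⟩ := ih (by omega) fun n hn => h n (by omega)
    have h2 := h D (by omega)
    rw [hr, eval_thetaDeriv_iterate_X_sub_C_pow_mul] at h2
    have hf : (D.factorial : ZMod p) ≠ 0 := by
      rw [Ne, ZMod.natCast_eq_zero_iff, (Fact.out : p.Prime).dvd_factorial]; omega
    have hk : (k * (1 - k)) ^ D ≠ 0 :=
      pow_ne_zero _ (mul_ne_zero h0 (sub_ne_zero.2 h1.symm))
    have hr0 : r.eval k = 0 := by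
      rcases mul_eq_zero.1 h2 with h3 | h3
      · exact absurd h3 (mul_ne_zero hf hk)
      · exact h3
    obtain ⟨t, ht⟩ := dvd_iff_isRoot.2 hr0
    exact ⟨t, by rw [hr, ht, pow_succ]; ring⟩

/-- The value of `(X (1 - X) d/dX)^n` applied to `(1 - X) ^ a * f ^ b * X ^ (p c)`, as a polynomial
in the point `k`, at the points `k` of `ZMod p` where the truncated logarithm `f` equals `r`. It has
low degree because `X ^ p` takes the value `k`. The truncated `b - 1` at `b = 0` is harmless, since
it occurs with the factor `b`. -/
noncomputable def thetaValue (r : ZMod p) : ℕ → ℕ → ℕ → ℕ → (ZMod p)[X]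
  | 0, a, b, c => C (r ^ b) * ((1 - X) ^ a * X ^ c)
  | n + 1, a, b, c => C (a : ZMod p) * (thetaValue r n (a + 1) b c - thetaValue r n a b c) +
      C (b : ZMod p) * (thetaValue r n a (b - 1) c - thetaValue r n (a + 1) (b - 1) c -
        thetaValue r n a (b - 1) (c + 1))

lemma natDegree_thetaValue_le (r : ZMod p) (n a b c : ℕ) :
    (thetaValue r n a b c).natDegree ≤ a + c + n := by
  induction n generalizing a b c with
  | zero =>
    have h1 : ((1 - X : (ZMod p)[X])).natDegree ≤ 1 :=
      (natDegree_sub_le _ _).trans (by simp)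
    refine (natDegree_C_mul_le _ _).trans (natDegree_mul_le.trans ?_)
    have := natDegree_pow_le_of_le a h1
    have h3 := natDegree_X_pow_le (R := ZMod p) c
    omega
  | succ n ih =>
    have h1 := ih (a + 1) b c
    have h2 := ih a b c
    have h3 := ih a (b - 1) c
    have h4 := ih (a + 1) (b - 1) c
    have h5 := ih a (b - 1) (c + 1)
    refine (natDegree_add_le _ _).trans (max_le ?_ ?_)
    · refine (natDegree_C_mul_le _ _).trans ((natDegree_sub_le _ _).trans (max_le ?_ ?_)) <;> omega
    · refine (natDegree_C_mul_le _ _).trans ((natDegree_sub_le _ _).trans (max_le ?_ ?_))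
      · refine (natDegree_sub_le _ _).trans (max_le ?_ ?_) <;> omega
      · omega

lemma thetaDeriv_monomial (a b c : ℕ) :
    thetaDeriv ((1 - X) ^ a * truncLog p ^ b * X ^ (p * c)) =
      (a : ZMod p) • ((1 - X) ^ (a + 1) * truncLog p ^ b * X ^ (p * c) -
        (1 - X) ^ a * truncLog p ^ b * X ^ (p * c)) +
      (b : ZMod p) • ((1 - X) ^ a * truncLog p ^ (b - 1) * X ^ (p * c) -
        (1 - X) ^ (a + 1) * truncLog p ^ (b - 1) * X ^ (p * c) -
        (1 - X) ^ a * truncLog p ^ (b - 1) * X ^ (p * (c + 1))) := by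
  have h1 : (1 - X : (ZMod p)[X]) * derivative ((1 - X) ^ a) = - C (a : ZMod p) * (1 - X) ^ a := by
    rw [derivative_pow]
    rcases a with _ | a
    · simp
    · simp [pow_succ]; ring
  have h2 := X_mul_one_sub_X_mul_derivative_truncLog (p := p)
  have h3 : derivative ((X : (ZMod p)[X]) ^ (p * c)) = 0 := by
    rw [derivative_X_pow]; simp
  rw [thetaDeriv_apply, derivative_mul, derivative_mul, h3, derivative_pow (truncLog p), mul_add p c 1,
    mul_one, pow_add, smul_eq_C_mul, smul_eq_C_mul]
  linear_combination (X * truncLog p ^ b * X ^ (p * c)) * h1 +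
    (C (b : ZMod p) * (1 - X) ^ a * truncLog p ^ (b - 1) * X ^ (p * c)) * h2

lemma eval_thetaDeriv_iterate_monomial {k r : ZMod p} (hk : (truncLog p).eval k = r)
    (n a b c : ℕ) :
    ((thetaDeriv ^ n) ((1 - X) ^ a * truncLog p ^ b * X ^ (p * c))).eval k =
      (thetaValue r n a b c).eval k := by
  induction n generalizing a b c with
  | zero => simp [thetaValue, hk, pow_mul]; ring
  | succ n ih =>
    rw [pow_succ, Module.End.mul_apply, thetaDeriv_monomial]
    simp only [map_add, map_smul, map_sub, eval_add, eval_smul, eval_sub, ih, thetaValue,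
      eval_mul, eval_C, smul_eq_mul]

end Stepanov

/-! ### Stepanov's method for the values of the truncated logarithm -/

section StepanovCount

open Polynomial Finset

variable {p : ℕ} [Fact p.Prime]

/-- A finite system of homogeneous linear equations with more unknowns than equations has a nonzero
solution; the unknowns are indexed by a finite set `s` and the equations by `ι`. -/
lemma exists_ne_zero_forall_sum_eq_zero {F α ι : Type*} [Field F] [Fintype ι]
    (s : Finset α) (L : ι → α → F) (h : Fintype.card ι < s.card) :
    ∃ u : α → F, (∃ x ∈ s, u x ≠ 0) ∧ ∀ i, ∑ x ∈ s, u x * L i x = 0 := by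
  classical
  let T : (s → F) →ₗ[F] (ι → F) :=
    LinearMap.pi fun i => ∑ x : s, L i x • LinearMap.proj x
  have hT : LinearMap.ker T ≠ ⊥ := LinearMap.ker_ne_bot_of_finrank_lt (by simpa using h)
  obtain ⟨v, hv, hv0⟩ := (Submodule.ne_bot_iff _).1 hT
  refine ⟨fun x => if hx : x ∈ s then v ⟨x, hx⟩ else 0, ?_, fun i => ?_⟩
  · obtain ⟨x, hx⟩ := Function.ne_iff.1 hv0
    exact ⟨x, x.2, by simpa using hx⟩
  · have := congrFun (LinearMap.mem_ker.1 hv) i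
    simp only [T, LinearMap.pi_apply, LinearMap.sum_apply, LinearMap.smul_apply,
      LinearMap.proj_apply, smul_eq_mul, Pi.zero_apply] at this
    rw [← Finset.sum_coe_sort s, ← this]
    refine Finset.sum_congr rfl fun x _ => ?_
    simp [mul_comm]

/-- The polynomials `(1 - X) ^ a * f ^ b * X ^ (p c)` with `a < A`, `b < B` and `A B ≤ p` are
linearly independent, `f` being the truncated logarithm. -/
lemma coeff_eq_zero_of_sum_monomial_eq_zero {A B C : ℕ} (hA : A ≤ p) (hAB : A * B ≤ p)
    (u : ℕ × ℕ × ℕ → ZMod p)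
    (h : ∑ t ∈ range A ×ˢ range B ×ˢ range C, Polynomial.C (u t) *
      ((1 - X) ^ t.1 * truncLog p ^ t.2.1 * X ^ (p * t.2.2)) = 0) :
    ∀ t ∈ range A ×ˢ range B ×ˢ range C, u t = 0 := by
  set G : ℕ → (ZMod p)[X] := fun c => ∑ a ∈ range A, (1 - X) ^ a *
    (∑ b ∈ range B, Polynomial.C (u (a, b, c)) * X ^ b).comp (truncLog p) with hG
  have hsum : ∑ c ∈ range C, X ^ (p * c) * G c = 0 := by
    rw [← h, Finset.sum_product, Finset.sum_congr rfl fun a _ => Finset.sum_product _ _ _,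
      Finset.sum_congr rfl fun a _ => Finset.sum_comm, Finset.sum_comm]
    refine Finset.sum_congr rfl fun c _ => ?_
    simp only [hG, Finset.mul_sum, Polynomial.sum_comp, mul_comp, C_comp, X_pow_comp]
    refine Finset.sum_congr rfl fun a _ => Finset.sum_congr rfl fun b _ => ?_
    ring
  have key : ∀ c, c < C → ∀ a ∈ range A, ∀ b ∈ range B, u (a, b, c) = 0 := by
    intro c
    induction c using Nat.strong_induction_on with
    | _ c ih =>
      intro hc
      have hlow : ∀ c' < c, G c' = 0 := fun c' hc' => by
        simp only [hG]
        refine Finset.sum_eq_zero fun a ha => ?_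
        rw [Finset.sum_eq_zero fun b hb => by rw [ih c' hc' (hc'.trans hc) a ha b hb]; simp]
        simp
      have hdvd : (X : (ZMod p)[X]) ^ (p * c) * X ^ p ∣ X ^ (p * c) * G c := by
        have e := Finset.add_sum_erase _ (fun c => X ^ (p * c) * G c) (mem_range.2 hc)
        rw [hsum] at e
        rw [eq_neg_of_add_eq_zero_left e]
        refine (Finset.dvd_sum fun c' hc' => ?_).neg_right
        rw [mem_erase] at hc'
        rcases lt_or_gt_of_ne hc'.1 with h1 | h1
        · simp [hlow c' h1]
        · refine Dvd.dvd.mul_right ?_ _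
          rw [← pow_add]
          exact pow_dvd_pow _ (by nlinarith)
      have hdvd' : (X : (ZMod p)[X]) ^ p ∣ G c :=
        (mul_dvd_mul_iff_left (pow_ne_zero _ X_ne_zero)).1 hdvd
      have hz := eq_zero_of_X_pow_dvd_sum_comp_truncLog hA p
        (fun a => ∑ b ∈ range B, Polynomial.C (u (a, b, c)) * X ^ b) le_rfl ?_ hdvd'
      · intro a ha b hb
        have := congrArg (fun q => coeff q b) (hz a ha)
        simpa [finsetSum_coeff, coeff_C_mul, coeff_X_pow, mem_range.1 hb] using this
      · refine (Finset.sum_le_card_nsmul _ _ B fun a _ => ?_).trans (by simpa using hAB)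
        unfold coeffCount
        split_ifs with h0
        · exact Nat.zero_le _
        · rcases Nat.eq_zero_or_pos B with rfl | hB
          · simp at h0
          have : (∑ b ∈ range B, Polynomial.C (u (a, b, c)) * X ^ b).natDegree ≤ B - 1 :=
            natDegree_sum_le_of_forall_le _ _ fun b hb => (natDegree_C_mul_X_pow_le _ _).trans
              (by have := mem_range.1 hb; omega)
          omega
  rintro ⟨a, b, c⟩ ht
  simp only [mem_product] at ht
  exact key c (mem_range.1 ht.2.2) a ht.1 b ht.2.1

/-- The degree and vanishing conditions of Stepanov's method for the equation `f(k) ∈ R`, `f` the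
truncated logarithm: an auxiliary polynomial with `A B C` coefficients vanishes to order `D` at
every solution. -/
lemma card_mul_le_of_stepanov (R K : Finset (ZMod p))
    (hK : ∀ k ∈ K, k ≠ 0 ∧ k ≠ 1 ∧ (truncLog p).eval k ∈ R) {A B C D : ℕ} (hD : D ≤ p)
    (hA : A ≤ p) (hAB : A * B ≤ p) (hcond : R.card * D * (A + C + D) < A * B * C) :
    K.card * D ≤ p * (B + C) := by
  classical
  have hp := (Fact.out : p.Prime).two_le
  obtain ⟨u, ⟨t₀, ht₀, hut₀⟩, hu⟩ := exists_ne_zero_forall_sum_eq_zero (F := ZMod p)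
    (ι := R × Fin D × Fin (A + C + D)) (range A ×ˢ range B ×ˢ range C)
    (fun i t => (thetaValue (i.1 : ZMod p) i.2.1 t.1 t.2.1 t.2.2).coeff i.2.2)
    (by simpa [mul_assoc] using hcond)
  set Ψ : (ZMod p)[X] := ∑ t ∈ range A ×ˢ range B ×ˢ range C, Polynomial.C (u t) *
      ((1 - X) ^ t.1 * truncLog p ^ t.2.1 * X ^ (p * t.2.2)) with hΨ
  have hΨ0 : Ψ ≠ 0 := fun h =>
    hut₀ (coeff_eq_zero_of_sum_monomial_eq_zero hA hAB u h t₀ ht₀)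
  have hvan : ∀ r ∈ R, ∀ n < D, ∑ t ∈ range A ×ˢ range B ×ˢ range C,
      Polynomial.C (u t) * thetaValue r n t.1 t.2.1 t.2.2 = 0 := by
    intro r hr n hn
    ext i
    simp only [finsetSum_coeff, coeff_C_mul, coeff_zero]
    by_cases hi : i < A + C + D
    · exact hu (⟨r, hr⟩, ⟨n, hn⟩, ⟨i, hi⟩)
    · refine Finset.sum_eq_zero fun t ht => ?_
      simp only [mem_product, mem_range] at ht
      rw [coeff_eq_zero_of_natDegree_lt, mul_zero]
      have := natDegree_thetaValue_le r n t.1 t.2.1 t.2.2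
      omega
  have hdvd : ∀ k ∈ K, (X - Polynomial.C k) ^ D ∣ Ψ := by
    intro k hk
    obtain ⟨h0, h1, hR⟩ := hK k hk
    refine X_sub_C_pow_dvd_of_eval_thetaDeriv_eq_zero h0 h1 hD fun n hn => ?_
    have h2 := congrArg (eval k) (hvan _ hR n hn)
    simp only [eval_finsetSum, eval_mul, eval_C, eval_zero] at h2
    rw [hΨ, map_sum, eval_finsetSum, ← h2]
    refine Finset.sum_congr rfl fun t _ => ?_
    rw [← smul_eq_C_mul, map_smul, eval_smul, eval_thetaDeriv_iterate_monomial rfl, smul_eq_mul]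
  have hprod : ∏ k ∈ K, (X - Polynomial.C k) ^ D ∣ Ψ := by
    refine Finset.prod_dvd_of_coprime (fun a _ b _ hab => ?_) hdvd
    exact (pairwise_coprime_X_sub_C Function.injective_id hab).pow
  have hdeg := natDegree_le_of_dvd hprod hΨ0
  rw [natDegree_prod_of_monic _ _ fun k _ => (monic_X_sub_C k).pow D] at hdeg
  simp only [natDegree_pow, natDegree_X_sub_C, mul_one, sum_const, smul_eq_mul] at hdeg
  refine hdeg.trans ?_
  refine natDegree_sum_le_of_forall_le _ _ fun t ht => ?_
  simp only [mem_product, mem_range] at ht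
  refine (natDegree_C_mul_le _ _).trans (natDegree_mul_le.trans
    ((Nat.add_le_add_right natDegree_mul_le _).trans ?_))
  have h1 : ((1 - X : (ZMod p)[X])).natDegree ≤ 1 := (natDegree_sub_le _ _).trans (by simp)
  have h2 := natDegree_pow_le_of_le t.1 h1
  have h3 := natDegree_pow_le_of_le t.2.1 (natDegree_truncLog_le p)
  have h4 := natDegree_X_pow_le (R := ZMod p) (p * t.2.2)
  have h5 : t.2.1 * (p - 1) ≤ (B - 1) * p := Nat.mul_le_mul (by omega) (by omega)
  have h6 : p * t.2.2 + p ≤ p * C := by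
    rw [← Nat.mul_succ]; exact Nat.mul_le_mul_left _ ht.2.2
  have h7 : (B - 1) * p + p = p * B := by
    rw [← Nat.succ_mul, mul_comm]; congr 1; omega
  rw [mul_add]
  omega

/-- The number of `k ≠ 0, 1` in `ZMod p` at which the truncated logarithm takes the value `r`. -/
noncomputable def logCount (r : ZMod p) : ℕ :=
  #{k : ZMod p | k ≠ 0 ∧ k ≠ 1 ∧ (truncLog p).eval k = r}

lemma sum_logCount (R : Finset (ZMod p)) :
    ∑ r ∈ R, logCount r = #{k : ZMod p | k ≠ 0 ∧ k ≠ 1 ∧ (truncLog p).eval k ∈ R} := by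
  rw [Finset.card_eq_sum_card_fiberwise (f := fun k => (truncLog p).eval k) (t := R)]
  · refine Finset.sum_congr rfl fun r hr => ?_
    rw [logCount, Finset.filter_filter]
    congr 1
    ext k
    simp only [mem_filter, mem_univ, true_and]
    constructor
    · rintro ⟨h0, h1, h2⟩; exact ⟨⟨h0, h1, h2 ▸ hr⟩, h2⟩
    · rintro ⟨⟨h0, h1, _⟩, h2⟩; exact ⟨h0, h1, h2⟩
  · intro k hk
    simp only [coe_filter, mem_univ, true_and, Set.mem_ofPred_eq] at hk
    exact hk.2.2

lemma sum_logCount_le (R : Finset (ZMod p)) : ∑ r ∈ R, logCount r ≤ p := by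
  rw [sum_logCount]
  exact (Finset.card_le_univ _).trans (by simp [ZMod.card])

/-- Few values of the truncated logarithm are taken often, for a small set of values. -/
lemma pow_three_mul_card_le_of_sq_le {R : Finset (ZMod p)} {t : ℕ} (ht : ∀ r ∈ R, t ≤ logCount r)
    (hR : 2 * R.card ^ 2 ≤ p) (hp8 : 8 ≤ p) : t ^ 3 * R.card ≤ 2 ^ 17 * p ^ 2 := by
  have hp := (Fact.out : p.Prime).two_le
  rcases R.eq_empty_or_nonempty with rfl | hne
  · simp
  have hR1 : 1 ≤ R.card := hne.card_pos
  set m := R.card with hm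
  -- `A` is the integer part of `(p ^ 2 / (16 m)) ^ (1 / 3)`
  obtain ⟨A, hA1, hA2, hA3⟩ : ∃ A, 1 ≤ A ∧ 16 * m * A ^ 3 ≤ p ^ 2 ∧ p ^ 2 < 16 * m * (A + 1) ^ 3 := by
    have hbd : ∃ n, p ^ 2 < 16 * m * (n + 1) ^ 3 := ⟨p, by
      have h1 : p ^ 2 < (p + 1) ^ 2 := Nat.pow_lt_pow_left (by omega) (by norm_num)
      have h2 : (p + 1) ^ 2 ≤ (p + 1) ^ 3 := Nat.pow_le_pow_right (by omega) (by norm_num)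
      nlinarith⟩
    classical
    refine ⟨Nat.find hbd, ?_, ?_, Nat.find_spec hbd⟩
    · rw [Nat.one_le_iff_ne_zero, Ne, Nat.find_eq_zero]
      push Not
      nlinarith
    · rcases h : Nat.find hbd with _ | n
      · simp
      · have := Nat.find_min hbd (m := n) (by omega)
        omega
  have h3mA : 3 * m * A ≤ p := by
    refine le_of_not_gt fun h => ?_
    have h1 : p ^ 3 < (3 * m * A) ^ 3 := Nat.pow_lt_pow_left h (by norm_num)
    have h2 : 16 * (3 * m * A) ^ 3 ≤ 27 * m ^ 2 * p ^ 2 := by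
      calc 16 * (3 * m * A) ^ 3 = 27 * m ^ 2 * (16 * m * A ^ 3) := by ring
        _ ≤ _ := Nat.mul_le_mul_left _ hA2
    have h3 : m ^ 2 * p ^ 2 * 2 ≤ p * p ^ 2 := by nlinarith [pow_pos (by omega : 0 < p) 2]
    nlinarith
  have hAp : A ≤ p := by nlinarith
  set B := p / A with hB
  have hAB : A * B ≤ p := Nat.mul_div_le p A
  have hAB' : p < A * (B + 1) := Nat.lt_mul_div_succ p hA1
  have hB3 : 3 * m ≤ B := by
    rw [hB, Nat.le_div_iff_mul_le hA1]; exact h3mA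
  have hB4 : 4 * m * A < B ^ 2 := by
    have h1 : 16 * m * A ^ 3 < A ^ 2 * (B + 1) ^ 2 := by
      calc 16 * m * A ^ 3 ≤ p ^ 2 := hA2
        _ < (A * (B + 1)) ^ 2 := Nat.pow_lt_pow_left hAB' (by norm_num)
        _ = _ := by ring
    have h2 : 16 * m * A < (B + 1) ^ 2 := by
      refine Nat.lt_of_mul_lt_mul_left (a := A ^ 2) ?_
      calc A ^ 2 * (16 * m * A) = 16 * m * A ^ 3 := by ring
        _ < _ := h1
    nlinarith
  have hcond : m * A * (A + B + A) < A * B * B := by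
    have : m * (2 * A + B) < B * B := by nlinarith
    calc m * A * (A + B + A) = A * (m * (2 * A + B)) := by ring
      _ < A * (B * B) := Nat.mul_lt_mul_of_pos_left this hA1
      _ = _ := by ring
  have hst := card_mul_le_of_stepanov R
    {k : ZMod p | k ≠ 0 ∧ k ≠ 1 ∧ (truncLog p).eval k ∈ R} (by simp) hAp hAp hAB hcond
  rw [← sum_logCount] at hst
  have hsum : t * m ≤ ∑ r ∈ R, logCount r := by
    have := Finset.card_nsmul_le_sum R logCount t ht
    simpa [mul_comm] using this
  have h5 : t * m * A ^ 2 ≤ 2 * p ^ 2 := by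
    calc t * m * A ^ 2 ≤ (∑ r ∈ R, logCount r) * A * A := by nlinarith
      _ ≤ p * (B + B) * A := Nat.mul_le_mul_right _ hst
      _ = 2 * p * (A * B) := by ring
      _ ≤ 2 * p * p := Nat.mul_le_mul_left _ hAB
      _ = _ := by ring
  have h6 : p ^ 2 ≤ 128 * m * A ^ 3 := by
    have : (A + 1) ^ 3 ≤ (2 * A) ^ 3 := Nat.pow_le_pow_left (by omega) 3
    nlinarith
  have h7 : p ^ 4 * (t ^ 3 * m) * m ^ 2 ≤ p ^ 4 * (2 ^ 17 * p ^ 2) * m ^ 2 := by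
    calc p ^ 4 * (t ^ 3 * m) * m ^ 2 = (p ^ 2) ^ 2 * (t ^ 3 * m ^ 3) := by ring
      _ ≤ (128 * m * A ^ 3) ^ 2 * (t ^ 3 * m ^ 3) :=
        Nat.mul_le_mul_right _ (Nat.pow_le_pow_left h6 2)
      _ = 2 ^ 14 * m ^ 2 * (t * m * A ^ 2) ^ 3 := by ring
      _ ≤ 2 ^ 14 * m ^ 2 * (2 * p ^ 2) ^ 3 := Nat.mul_le_mul_left _ (Nat.pow_le_pow_left h5 3)
      _ = _ := by ring
  exact Nat.le_of_mul_le_mul_left (Nat.le_of_mul_le_mul_right h7 (by positivity)) (by positivity)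

/-- The decay of the level sets of `logCount`, from Stepanov's method. -/
theorem pow_three_mul_card_le (hp8 : 8 ≤ p) (t : ℕ) :
    t ^ 3 * #{r : ZMod p | t ≤ logCount r} ≤ 2 ^ 17 * p ^ 2 := by
  set R : Finset (ZMod p) := {r : ZMod p | t ≤ logCount r} with hR
  have ht : ∀ r ∈ R, t ≤ logCount r := fun r hr => by simpa [hR] using hr
  rcases le_or_gt (2 * R.card ^ 2) p with h | h
  · exact pow_three_mul_card_le_of_sq_le ht h hp8
  · -- a large level set is handled by the trivial bound for the total mass
    have h1 : t * R.card ≤ p := by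
      have := Finset.card_nsmul_le_sum R logCount t ht
      rw [smul_eq_mul, mul_comm] at this
      exact this.trans (sum_logCount_le R)
    have h2 : (t * R.card) ^ 3 ≤ p ^ 3 := Nat.pow_le_pow_left h1 3
    have h3 : p * (t ^ 3 * R.card) ≤ p * (2 * p ^ 2) := by
      calc p * (t ^ 3 * R.card) ≤ (2 * R.card ^ 2) * (t ^ 3 * R.card) :=
            Nat.mul_le_mul_right _ h.le
        _ = 2 * (t * R.card) ^ 3 := by ring
        _ ≤ 2 * p ^ 3 := Nat.mul_le_mul_left _ h2
        _ = _ := by ring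
    have := Nat.le_of_mul_le_mul_left h3 (by omega)
    omega

end StepanovCount

/-! ### Moments from the decay of level sets -/

section LayerCake

open Finset

variable {ι : Type*} [Fintype ι] {h : ι → ℕ} {K : ℝ}

/-- Cubic decay of the level sets gives a third moment with only a logarithmic loss. -/
lemma sum_pow_three_le_of_decay (hK : ∀ t : ℕ, (t : ℝ) ^ 3 * #{i | t ≤ h i} ≤ K) {n : ℕ}
    (hn : ∀ i, h i ≤ n) : ∑ i, (h i : ℝ) ^ 3 ≤ 3 * K * (1 + Real.log n) := by
  have hK0 : 0 ≤ K := by simpa using hK 0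
  have h1 : ∀ m : ℕ, (m : ℝ) ^ 3 ≤ ∑ t ∈ Icc 1 m, 3 * (t : ℝ) ^ 2 := by
    intro m
    induction m with
    | zero => simp
    | succ m ih =>
      rw [Finset.sum_Icc_succ_top (by omega)]
      push_cast
      have : (0 : ℝ) ≤ m := Nat.cast_nonneg m
      nlinarith
  have h2 : ∀ i, (h i : ℝ) ^ 3 ≤ ∑ t ∈ Icc 1 n, if t ≤ h i then 3 * (t : ℝ) ^ 2 else 0 := by
    intro i
    rw [← Finset.sum_filter]
    refine (h1 (h i)).trans (Finset.sum_le_sum_of_subset_of_nonneg ?_ fun _ _ _ => by positivity)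
    intro t ht
    have := hn i
    simp only [mem_filter, mem_Icc] at ht ⊢
    omega
  calc ∑ i, (h i : ℝ) ^ 3 ≤ ∑ i, ∑ t ∈ Icc 1 n, if t ≤ h i then 3 * (t : ℝ) ^ 2 else 0 :=
        Finset.sum_le_sum fun i _ => h2 i
    _ = ∑ t ∈ Icc 1 n, 3 * (t : ℝ) ^ 2 * #{i | t ≤ h i} := by
        rw [Finset.sum_comm]
        refine Finset.sum_congr rfl fun t _ => ?_
        rw [← Finset.sum_filter, Finset.sum_const, nsmul_eq_mul, mul_comm]
    _ ≤ ∑ t ∈ Icc 1 n, 3 * K * (t : ℝ)⁻¹ := by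
        refine Finset.sum_le_sum fun t ht => ?_
        have ht0 : (0 : ℝ) < t := by have := (mem_Icc.1 ht).1; positivity
        rw [← div_eq_mul_inv, le_div_iff₀ ht0]
        have := hK t
        nlinarith
    _ = 3 * K * (harmonic n : ℝ) := by
        rw [harmonic_eq_sum_Icc]; push_cast; rw [Finset.mul_sum]
    _ ≤ _ := by
        have := harmonic_le_one_add_log n
        gcongr

/-- Cubic decay of the level sets bounds the part of the second moment over large values. -/
lemma sum_sq_filter_le_of_decay (hK : ∀ t : ℕ, (t : ℝ) ^ 3 * #{i | t ≤ h i} ≤ K) {τ : ℝ}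
    (hτ : 0 < τ) : ∑ i with τ < h i, (h i : ℝ) ^ 2 ≤ 3 * K / τ := by
  classical
  have hK0 : 0 ≤ K := by simpa using hK 0
  set m := ⌈τ⌉₊ with hm
  have hm0 : 0 < m := Nat.ceil_pos.2 hτ
  have hm0' : (0 : ℝ) < m := by exact_mod_cast hm0
  have hmτ : τ ≤ m := Nat.le_ceil τ
  set n := m + ∑ i, h i with hn
  have hn' : ∀ i, h i ≤ n := fun i =>
    (Finset.single_le_sum (f := h) (fun _ _ => Nat.zero_le _) (mem_univ i)).trans (by omega)
  have h1 : ∀ k : ℕ, m ≤ k → (k : ℝ) ^ 2 ≤ (m : ℝ) ^ 2 + ∑ t ∈ Ioc m k, 2 * (t : ℝ) := by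
    intro k hk
    induction k, hk using Nat.le_induction with
    | base => simp
    | succ k hk ih =>
      rw [← Finset.sum_Ioc_consecutive _ hk (Nat.le_succ k), Nat.Ioc_succ_singleton, sum_singleton]
      push_cast
      nlinarith
  have h2 : ∀ i, m ≤ h i → (h i : ℝ) ^ 2 ≤
      (m : ℝ) ^ 2 + ∑ t ∈ Ioc m n, if t ≤ h i then 2 * (t : ℝ) else 0 := by
    intro i hi
    rw [← Finset.sum_filter]
    refine (h1 (h i) hi).trans (add_le_add le_rfl
      (Finset.sum_le_sum_of_subset_of_nonneg ?_ fun _ _ _ => by positivity))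
    intro t ht
    have := hn' i
    simp only [mem_filter, mem_Ioc] at ht ⊢
    omega
  calc ∑ i with τ < h i, (h i : ℝ) ^ 2 ≤ ∑ i with m ≤ h i, (h i : ℝ) ^ 2 := by
        refine Finset.sum_le_sum_of_subset_of_nonneg ?_ fun _ _ _ => by positivity
        intro i hi
        simp only [mem_filter, mem_univ, true_and] at hi ⊢
        exact Nat.ceil_le.2 hi.le
    _ ≤ ∑ i with m ≤ h i, ((m : ℝ) ^ 2 + ∑ t ∈ Ioc m n, if t ≤ h i then 2 * (t : ℝ) else 0) :=
        Finset.sum_le_sum fun i hi => h2 i (by simpa using hi)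
    _ ≤ (m : ℝ) ^ 2 * #{i | m ≤ h i} +
          ∑ i, ∑ t ∈ Ioc m n, if t ≤ h i then 2 * (t : ℝ) else 0 := by
        rw [Finset.sum_add_distrib, Finset.sum_const, nsmul_eq_mul, mul_comm]
        refine add_le_add le_rfl (Finset.sum_le_sum_of_subset_of_nonneg (Finset.subset_univ _) ?_)
        intro i _ _
        exact Finset.sum_nonneg fun t _ => by split_ifs <;> positivity
    _ = (m : ℝ) ^ 2 * #{i | m ≤ h i} + ∑ t ∈ Ioc m n, 2 * (t : ℝ) * #{i | t ≤ h i} := by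
        rw [Finset.sum_comm]
        congr 1
        refine Finset.sum_congr rfl fun t _ => ?_
        rw [← Finset.sum_filter, Finset.sum_const, nsmul_eq_mul, mul_comm]
    _ ≤ K / m + ∑ t ∈ Ioc m n, 2 * K * ((t : ℝ) ^ 2)⁻¹ := by
        refine add_le_add ?_ (Finset.sum_le_sum fun t ht => ?_)
        · rw [le_div_iff₀ hm0']
          have := hK m
          nlinarith
        · have ht0 : (0 : ℝ) < t := by have := (mem_Ioc.1 ht).1; exact_mod_cast (by omega)
          rw [← div_eq_mul_inv, le_div_iff₀ (by positivity)]
          have := hK t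
          nlinarith
    _ ≤ K / m + 2 * K * (m : ℝ)⁻¹ := by
        rw [← Finset.mul_sum]
        have := sum_Ioc_inv_sq_le_sub (α := ℝ) hm0.ne' (show m ≤ n by omega)
        have h3 : (0 : ℝ) ≤ (n : ℝ)⁻¹ := by positivity
        gcongr
        linarith
    _ = 3 * K / m := by field_simp; ring
    _ ≤ 3 * K / τ := by gcongr

end LayerCake

/-! ### Autocorrelations on a finite abelian group -/

section Correlation

open Finset

variable {G : Type*} [AddCommGroup G] [Fintype G]

/-- The autocorrelation of a function on a finite abelian group. For the indicator function of a
set, the value at `z` is the number of ways to write `z` as a difference of two elements. -/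
def autocorr (I : G → ℝ) (z : G) : ℝ := ∑ y, I y * I (y + z)

lemma autocorr_neg (I : G → ℝ) (z : G) : autocorr I (-z) = autocorr I z := by
  unfold autocorr
  rw [← Equiv.sum_comp (Equiv.addRight z)]
  refine Finset.sum_congr rfl fun y _ => ?_
  simp [mul_comm]

lemma sum_mul_sum_sub_eq_sum_autocorr (I H : G → ℝ) :
    ∑ x, I x * ∑ y, I y * H (x - y) = ∑ s, autocorr I s * H s := by
  unfold autocorr
  simp only [Finset.mul_sum, Finset.sum_mul]
  rw [Finset.sum_comm, Finset.sum_comm (s := univ) (t := univ) (f := fun s y => I y * I (y + s) * H s)]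
  refine Finset.sum_congr rfl fun y _ => ?_
  rw [← Equiv.sum_comp (Equiv.addLeft y)]
  refine Finset.sum_congr rfl fun s _ => ?_
  simp only [Equiv.coe_addLeft, add_sub_cancel_left]
  ring

lemma autocorr_sub (I : G → ℝ) (y y' : G) :
    autocorr I (y - y') = ∑ z, I (y + z) * I (y' + z) := by
  unfold autocorr
  rw [← Equiv.sum_comp (Equiv.addLeft y')]
  refine Finset.sum_congr rfl fun z _ => ?_
  simp only [Equiv.coe_addLeft]
  rw [mul_comm]; congr 2; abel

omit [AddCommGroup G] in
lemma sum_sq_mul_le (I F : G → ℝ) (hI : ∀ x, 0 ≤ I x) :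
    (∑ x, I x * F x) ^ 2 ≤ (∑ x, I x) * ∑ x, I x * F x ^ 2 :=
  Finset.sum_sq_le_sum_mul_sum_of_sq_le_mul _ (fun x _ => hI x)
    (fun x _ => mul_nonneg (hI x) (sq_nonneg _)) fun x _ => le_of_eq (by ring)

/-- The weighted energy inequality: the matrix `autocorr I (y - y')` is positive semidefinite, and
the constant vector is an eigenvector of the matrix `w (x - y)` with eigenvalue `μ`. -/
lemma sq_mul_sum_autocorr_sq_le (I w : G → ℝ) (hI : ∀ x, 0 ≤ I x) {μ : ℝ}
    (hw : ∀ y, I y ≠ 0 → ∑ x, I x * w (x - y) = μ) :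
    μ ^ 2 * ∑ s, autocorr I s ^ 2 ≤ (∑ x, I x) *
      ∑ x, I x * ∑ y, I y * w (x - y) * ∑ y', I y' * w (x - y') * autocorr I (y - y') := by
  have h1 : ∀ z, ∑ x, I x * ∑ y, I y * w (x - y) * I (y + z) = μ * autocorr I z := by
    intro z
    simp only [Finset.mul_sum, autocorr]
    rw [Finset.sum_comm]
    refine Finset.sum_congr rfl fun y _ => ?_
    by_cases hy : I y = 0
    · simp [hy]
    · rw [← hw y hy, Finset.sum_mul]
      refine Finset.sum_congr rfl fun x _ => ?_
      ring
  have h2 : ∀ x, ∑ y, I y * w (x - y) * ∑ y', I y' * w (x - y') * autocorr I (y - y') =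
      ∑ z, (∑ y, I y * w (x - y) * I (y + z)) ^ 2 := by
    intro x
    simp only [autocorr_sub, sq, Finset.sum_mul_sum]
    rw [Finset.sum_comm]
    refine Finset.sum_congr rfl fun y _ => ?_
    rw [Finset.sum_comm, Finset.mul_sum]
    refine Finset.sum_congr rfl fun y' _ => ?_
    rw [Finset.mul_sum, Finset.mul_sum]
    refine Finset.sum_congr rfl fun z _ => ?_
    ring
  calc μ ^ 2 * ∑ s, autocorr I s ^ 2
      = ∑ z, (∑ x, I x * ∑ y, I y * w (x - y) * I (y + z)) ^ 2 := by
        rw [Finset.mul_sum]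
        refine Finset.sum_congr rfl fun z _ => ?_
        rw [h1, mul_pow]
    _ ≤ ∑ z, (∑ x, I x) * ∑ x, I x * (∑ y, I y * w (x - y) * I (y + z)) ^ 2 :=
        Finset.sum_le_sum fun z _ => sum_sq_mul_le I _ hI
    _ = _ := by
        rw [← Finset.mul_sum, Finset.sum_comm]
        congr 1
        refine Finset.sum_congr rfl fun x _ => ?_
        rw [h2, Finset.mul_sum]

/-- The number of triples with prescribed differences has second moment equal to the third moment
of the autocorrelation. -/
lemma sum_triple_corr_sq (I : G → ℝ) :
    ∑ q : G × G, (∑ x, I x * I (x - q.1) * I (x - q.2)) ^ 2 = ∑ s, autocorr I s ^ 3 := by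
  have h1 : ∀ x x' : G, ∑ α, I (x - α) * I (x' - α) = autocorr I (x - x') := by
    intro x x'
    rw [autocorr_sub, ← Equiv.sum_comp (Equiv.neg G)]
    simp [sub_neg_eq_add]
  have h2 : ∀ q : G × G, (∑ x, I x * I (x - q.1) * I (x - q.2)) ^ 2 =
      ∑ x, ∑ x', I x * I x' * ((I (x - q.1) * I (x' - q.1)) * (I (x - q.2) * I (x' - q.2))) := by
    intro q
    rw [sq, Finset.sum_mul_sum]
    refine Finset.sum_congr rfl fun x _ => Finset.sum_congr rfl fun x' _ => ?_
    ring
  rw [Finset.sum_congr rfl fun q _ => h2 q, Finset.sum_comm]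
  rw [Finset.sum_congr rfl fun x _ => Finset.sum_comm]
  have h3 : ∀ x x' : G, ∑ q : G × G, I x * I x' *
      ((I (x - q.1) * I (x' - q.1)) * (I (x - q.2) * I (x' - q.2))) =
      I x * (I x' * autocorr I (x - x') ^ 2) := by
    intro x x'
    rw [← Finset.mul_sum, Fintype.sum_prod_type, ← h1, sq, Finset.sum_mul_sum]
    ring
  simp only [h3, ← Finset.mul_sum]
  rw [sum_mul_sum_sub_eq_sum_autocorr I (fun s => autocorr I s ^ 2)]
  refine Finset.sum_congr rfl fun s _ => ?_
  ring

/-- The Cauchy–Schwarz inequality for a sum over triples, grouped by their differences. -/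
lemma sq_sum_triple_le (I w v : G → ℝ) :
    (∑ x, I x * ∑ y, I y * w (x - y) * ∑ y', I y' * w (x - y') * v (y - y')) ^ 2 ≤
      (∑ s, autocorr I s ^ 3) * ∑ α, ∑ β, w α ^ 2 * w β ^ 2 * v (β - α) ^ 2 := by
  have h1 : ∑ x, I x * ∑ y, I y * w (x - y) * ∑ y', I y' * w (x - y') * v (y - y') =
      ∑ q : G × G, (∑ x, I x * I (x - q.1) * I (x - q.2)) * (w q.1 * w q.2 * v (q.2 - q.1)) := by
    simp only [Finset.sum_mul]
    rw [Finset.sum_comm]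
    refine Finset.sum_congr rfl fun x _ => ?_
    rw [Fintype.sum_prod_type, Finset.mul_sum, ← Equiv.sum_comp (Equiv.subLeft x)]
    refine Finset.sum_congr rfl fun α _ => ?_
    rw [Finset.mul_sum, Finset.mul_sum, ← Equiv.sum_comp (Equiv.subLeft x)]
    refine Finset.sum_congr rfl fun β _ => ?_
    simp only [Equiv.subLeft_apply, sub_sub_cancel, sub_sub_sub_cancel_left]
    ring
  rw [h1, ← sum_triple_corr_sq]
  refine (Finset.sum_mul_sq_le_sq_mul_sq _ _ _).trans (le_of_eq ?_)
  congr 1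
  rw [Fintype.sum_prod_type]
  refine Finset.sum_congr rfl fun α _ => Finset.sum_congr rfl fun β _ => ?_
  ring

/-- An energy inequality for the autocorrelation `g` of a set with constant row sums: `g` is split
into its value at `0`, a large part `b` and the rest `v`, and `w` is a truncation of `g`. -/
lemma sq_mul_energy_le (I w v b : G → ℝ) (hI : ∀ x, 0 ≤ I x) {P μ β : ℝ}
    (hP : ∑ x, I x = P) (hw : ∀ y, I y ≠ 0 → ∑ x, I x * w (x - y) = μ) (hb0 : ∀ s, 0 ≤ b s)
    (hbsymm : ∀ s, b (-s) = b s)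
    (hb : ∀ y, I y ≠ 0 → ∑ x, I x * b (x - y) = β)
    (hI1 : ∀ x, I x ≤ 1)
    (hsplit : ∀ s, s ≠ 0 → autocorr I s ≤ v s + b s) (h0 : autocorr I 0 ≤ P) (hv0 : 0 ≤ v 0)
    (hw0 : ∀ s, 0 ≤ w s) :
    μ ^ 2 * ∑ s, autocorr I s ^ 2 ≤ P * ((P + β) * ∑ s, autocorr I s * w s ^ 2 +
      √((∑ s, autocorr I s ^ 3) * ∑ α, ∑ β, w α ^ 2 * w β ^ 2 * v (β - α) ^ 2)) := by
  classical
  have hP0 : 0 ≤ P := hP ▸ Finset.sum_nonneg fun x _ => hI x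
  refine (sq_mul_sum_autocorr_sq_le I w hI hw).trans ?_
  rw [hP]
  refine mul_le_mul_of_nonneg_left ?_ hP0
  have hW : ∑ x, I x * ∑ y, I y * w (x - y) ^ 2 = ∑ s, autocorr I s * w s ^ 2 :=
    sum_mul_sum_sub_eq_sum_autocorr I (fun s => w s ^ 2)
  -- the diagonal `y = y'`
  have hdiag : ∑ x, I x * ∑ y, I y * w (x - y) * ∑ y', I y' * w (x - y') *
      (if y - y' = 0 then P else 0) ≤ P * ∑ s, autocorr I s * w s ^ 2 := by
    rw [← hW, Finset.mul_sum]
    refine Finset.sum_le_sum fun x _ => ?_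
    rw [mul_left_comm]
    refine mul_le_mul_of_nonneg_left ?_ (hI x)
    rw [Finset.mul_sum]
    refine Finset.sum_le_sum fun y _ => ?_
    have : ∑ y', I y' * w (x - y') * (if y - y' = 0 then P else 0) = I y * w (x - y) * P := by
      rw [Finset.sum_eq_single y]
      · simp
      · intro y' _ hne
        rw [if_neg (by rw [sub_eq_zero]; exact hne.symm), mul_zero]
      · simp
    rw [this]
    have h3 : I y * I y ≤ I y := by nlinarith [hI y, hI1 y]
    have h4 : 0 ≤ w (x - y) ^ 2 * P := mul_nonneg (sq_nonneg _) hP0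
    nlinarith
  -- the large values, by `2 a b ≤ a ^ 2 + b ^ 2`
  have hlarge : ∑ x, I x * ∑ y, I y * w (x - y) * ∑ y', I y' * w (x - y') * b (y - y') ≤
      β * ∑ s, autocorr I s * w s ^ 2 := by
    rw [← hW, Finset.mul_sum]
    refine Finset.sum_le_sum fun x _ => ?_
    rw [mul_left_comm]
    refine mul_le_mul_of_nonneg_left ?_ (hI x)
    have e1 : ∑ y, ∑ y', I y * I y' * w (x - y) ^ 2 * b (y - y') =
        β * ∑ y, I y * w (x - y) ^ 2 := by
      rw [Finset.mul_sum]
      refine Finset.sum_congr rfl fun y _ => ?_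
      by_cases hy : I y = 0
      · simp [hy]
      · rw [← hb y hy, Finset.sum_mul]
        refine Finset.sum_congr rfl fun y' _ => ?_
        rw [← hbsymm (y - y'), neg_sub]; ring
    have e2 : ∑ y, ∑ y', I y * I y' * w (x - y') ^ 2 * b (y - y') =
        β * ∑ y, I y * w (x - y) ^ 2 := by
      rw [← e1, Finset.sum_comm]
      refine Finset.sum_congr rfl fun y _ => Finset.sum_congr rfl fun y' _ => ?_
      rw [← hbsymm (y - y'), neg_sub]; ring
    have e3 : ∑ y, I y * w (x - y) * ∑ y', I y' * w (x - y') * b (y - y') ≤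
        ∑ y, ∑ y', (I y * I y' * w (x - y) ^ 2 * b (y - y') +
          I y * I y' * w (x - y') ^ 2 * b (y - y')) / 2 := by
      refine Finset.sum_le_sum fun y _ => ?_
      rw [Finset.mul_sum]
      refine Finset.sum_le_sum fun y' _ => ?_
      have h5 : 0 ≤ I y * I y' * b (y - y') :=
        mul_nonneg (mul_nonneg (hI y) (hI y')) (hb0 _)
      nlinarith [mul_nonneg h5 (sq_nonneg (w (x - y) - w (x - y')))]
    refine e3.trans (le_of_eq ?_)
    simp only [← Finset.sum_div, Finset.sum_add_distrib]
    rw [e1, e2]; ring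
  have hmid : ∑ x, I x * ∑ y, I y * w (x - y) * ∑ y', I y' * w (x - y') * v (y - y') ≤
      √((∑ s, autocorr I s ^ 3) * ∑ α, ∑ β, w α ^ 2 * w β ^ 2 * v (β - α) ^ 2) :=
    Real.le_sqrt_of_sq_le (sq_sum_triple_le I w v)
  have hall : ∑ x, I x * ∑ y, I y * w (x - y) * ∑ y', I y' * w (x - y') * autocorr I (y - y') ≤
      ∑ x, I x * ∑ y, I y * w (x - y) * ∑ y', I y' * w (x - y') * (if y - y' = 0 then P else 0) +
      ∑ x, I x * ∑ y, I y * w (x - y) * ∑ y', I y' * w (x - y') * b (y - y') +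
      ∑ x, I x * ∑ y, I y * w (x - y) * ∑ y', I y' * w (x - y') * v (y - y') := by
    simp only [Finset.mul_sum, ← Finset.sum_add_distrib]
    refine Finset.sum_le_sum fun x _ => Finset.sum_le_sum fun y _ =>
      Finset.sum_le_sum fun y' _ => ?_
    have hc : 0 ≤ I x * (I y * w (x - y) * (I y' * w (x - y'))) :=
      mul_nonneg (hI x) (mul_nonneg (mul_nonneg (hI y) (hw0 _)) (mul_nonneg (hI y') (hw0 _)))
    have hs : autocorr I (y - y') ≤
        (if y - y' = 0 then P else 0) + b (y - y') + v (y - y') := by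
      split_ifs with hz
      · rw [hz]; linarith [hb0 0]
      · linarith [hsplit _ hz]
    nlinarith [mul_le_mul_of_nonneg_left hs hc]
  linarith

end Correlation

/-! ### The `p`-th powers modulo `p ^ 2` -/

section Teichmuller

open Finset Polynomial

variable {p : ℕ} [Fact p.Prime]

/-- The `p`-th power map from `ZMod p` to `ZMod (p ^ 2)`; the power does not depend on the
representative (`teichSq_intCast`). -/
def teichSq (k : ZMod p) : ZMod (p ^ 2) := (k.val : ZMod (p ^ 2)) ^ p

/-- Multiplication by `p`, as a map from `ZMod p` to `ZMod (p ^ 2)`. -/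
def mulP (x : ZMod p) : ZMod (p ^ 2) := (p : ZMod (p ^ 2)) * (x.val : ZMod (p ^ 2))

/-- Reduction modulo `p`. -/
def redP : ZMod (p ^ 2) →+* ZMod p := ZMod.castHom (dvd_pow_self p two_ne_zero) (ZMod p)

omit [Fact p.Prime] in
lemma intCast_eq_intCast_sq {m n : ℤ} :
    (m : ZMod (p ^ 2)) = n ↔ (p : ℤ) ^ 2 ∣ m - n := by
  rw [← sub_eq_zero, ← Int.cast_sub, ZMod.intCast_zmod_eq_zero_iff_dvd]
  push_cast; rfl

lemma teichSq_intCast (n : ℤ) : teichSq (n : ZMod p) = (n : ZMod (p ^ 2)) ^ p := by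
  have h1 : (p : ℤ) ∣ ((n : ZMod p).val : ℤ) - n := by
    rw [← ZMod.intCast_zmod_eq_zero_iff_dvd]; simp
  have h2 := dvd_sub_pow_of_dvd_sub (R := ℤ) h1 1
  rw [pow_one] at h2
  have h3 := (intCast_eq_intCast_sq (p := p)).2 h2
  push_cast at h3
  exact h3

lemma teichSq_natCast (n : ℕ) : teichSq (n : ZMod p) = (n : ZMod (p ^ 2)) ^ p := by
  simpa using teichSq_intCast (p := p) n

lemma mulP_intCast (n : ℤ) : mulP (n : ZMod p) = (p : ZMod (p ^ 2)) * n := by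
  have h1 : (p : ℤ) ∣ ((n : ZMod p).val : ℤ) - n := by
    rw [← ZMod.intCast_zmod_eq_zero_iff_dvd]; simp
  have h2 : (p : ℤ) ^ 2 ∣ p * ((n : ZMod p).val : ℤ) - p * n := by
    rw [← mul_sub, sq]; exact mul_dvd_mul_left _ h1
  have h3 := (intCast_eq_intCast_sq (p := p)).2 h2
  push_cast at h3
  exact h3

lemma exists_intCast_eq (x : ZMod p) : ∃ n : ℤ, (n : ZMod p) = x := ZMod.intCast_surjective x

lemma teichSq_mul (x y : ZMod p) : teichSq (x * y) = teichSq x * teichSq y := by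
  obtain ⟨m, rfl⟩ := exists_intCast_eq x
  obtain ⟨n, rfl⟩ := exists_intCast_eq y
  rw [← Int.cast_mul, teichSq_intCast, teichSq_intCast, teichSq_intCast]
  push_cast; rw [mul_pow]

lemma mulP_zero : mulP (0 : ZMod p) = 0 := by
  simpa using mulP_intCast (p := p) 0

lemma mulP_add (x y : ZMod p) : mulP (x + y) = mulP x + mulP y := by
  obtain ⟨m, rfl⟩ := exists_intCast_eq x
  obtain ⟨n, rfl⟩ := exists_intCast_eq y
  rw [← Int.cast_add, mulP_intCast, mulP_intCast, mulP_intCast]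
  push_cast; ring

lemma mulP_neg (x : ZMod p) : mulP (-x) = -mulP x := by
  rw [eq_neg_iff_add_eq_zero, ← mulP_add, neg_add_cancel, mulP_zero]

lemma mulP_sub (x y : ZMod p) : mulP (x - y) = mulP x - mulP y := by
  rw [sub_eq_add_neg, mulP_add, mulP_neg, sub_eq_add_neg]

lemma mulP_eq_zero {x : ZMod p} : mulP x = 0 ↔ x = 0 := by
  refine ⟨fun h => ?_, fun h => h ▸ mulP_zero⟩
  obtain ⟨n, rfl⟩ := exists_intCast_eq x
  rw [mulP_intCast] at h
  have h1 : (p : ℤ) ^ 2 ∣ p * n - 0 := intCast_eq_intCast_sq.1 (by push_cast; exact h)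
  have hp : (p : ℤ) ≠ 0 := by exact_mod_cast (Fact.out : p.Prime).ne_zero
  rw [sub_zero, sq] at h1
  exact (ZMod.intCast_zmod_eq_zero_iff_dvd _ _).2 ((mul_dvd_mul_iff_left hp).1 h1)

lemma mulP_injective : Function.Injective (mulP : ZMod p → ZMod (p ^ 2)) := fun x y h => by
  rwa [← sub_eq_zero, ← mulP_sub, mulP_eq_zero, sub_eq_zero] at h

lemma redP_intCast (n : ℤ) : redP (n : ZMod (p ^ 2)) = (n : ZMod p) := map_intCast _ n

lemma redP_teichSq (k : ZMod p) : redP (teichSq k) = k := by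
  obtain ⟨n, rfl⟩ := exists_intCast_eq k
  rw [teichSq_intCast, map_pow, redP_intCast, ZMod.pow_card]

lemma redP_mulP (x : ZMod p) : redP (mulP x) = 0 := by
  rw [mulP, map_mul, map_natCast, CharP.cast_eq_zero, zero_mul]

lemma mul_mulP (z : ZMod (p ^ 2)) (x : ZMod p) : z * mulP x = mulP (redP z * x) := by
  obtain ⟨m, rfl⟩ := ZMod.intCast_surjective z
  obtain ⟨n, rfl⟩ := exists_intCast_eq x
  rw [redP_intCast, ← Int.cast_mul, mulP_intCast, mulP_intCast]
  push_cast; ring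

lemma exists_mulP_of_redP_eq_zero {z : ZMod (p ^ 2)} (h : redP z = 0) : ∃ x, z = mulP x := by
  obtain ⟨n, rfl⟩ := ZMod.intCast_surjective z
  rw [redP_intCast, ZMod.intCast_zmod_eq_zero_iff_dvd] at h
  obtain ⟨m, rfl⟩ := h
  exact ⟨m, by rw [mulP_intCast]; push_cast; rfl⟩

lemma teichSq_zero : teichSq (0 : ZMod p) = 0 := by
  have h := teichSq_intCast (p := p) 0
  simpa [(Fact.out : p.Prime).ne_zero] using h

/-- A difference of two consecutive `p`-th powers modulo `p ^ 2` is described by the truncated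
logarithm. -/
lemma teichSq_sub_teichSq_sub_one (hp : p ≠ 2) (k : ZMod p) :
    teichSq k - teichSq (k - 1) = 1 - mulP ((truncLog p).eval k) := by
  have hodd : Odd p := (Fact.out : p.Prime).odd_of_ne_two hp
  have hp2 := (Fact.out : p.Prime).two_le
  obtain ⟨n, rfl⟩ := exists_intCast_eq k
  -- the binomial coefficients are `(-1) ^ j * C(p, j) = -p / j` modulo `p ^ 2`
  have hbin : ∀ j ∈ Ico 1 p, ((n : ZMod (p ^ 2)) ^ j * (-1) ^ (p - j) * (p.choose j : ZMod (p ^ 2))) =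
      mulP ((j : ZMod p)⁻¹ * (n : ZMod p) ^ j) := by
    intro j hj
    obtain ⟨hj1, hj2⟩ := mem_Ico.1 hj
    obtain ⟨c, hc⟩ := (Fact.out : p.Prime).dvd_choose_self (by omega) hj2
    have hj0 : (j : ZMod p) ≠ 0 := natCast_ne_zero_of_pos_of_lt (by omega) hj2
    -- `j c = C(p - 1, j - 1)`, which is `(-1) ^ (j - 1)` modulo `p`
    have hjc : (j : ZMod p) * c = (-1) ^ (j - 1) := by
      have h1 : c * j = (p - 1).choose (j - 1) := by
        have := Nat.add_one_mul_choose_eq (p - 1) (j - 1)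
        rw [Nat.sub_add_cancel (by omega), Nat.sub_add_cancel hj1, hc, mul_assoc] at this
        exact (Nat.eq_of_mul_eq_mul_left (by omega) this).symm
      have h2 : ∀ i, i ≤ p - 1 → ((p - 1).choose i : ZMod p) = (-1) ^ i := by
        intro i
        induction i with
        | zero => simp
        | succ i ih =>
          intro hi
          have h3 : p.choose (i + 1) = (p - 1).choose i + (p - 1).choose (i + 1) := by
            conv_lhs => rw [show p = (p - 1) + 1 by omega]
            rw [Nat.choose_succ_succ]
          have h4 : (p.choose (i + 1) : ZMod p) = 0 := by
            rw [ZMod.natCast_eq_zero_iff]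
            exact (Fact.out : p.Prime).dvd_choose_self (by omega) (by omega)
          rw [h3, Nat.cast_add, ih (by omega)] at h4
          rw [pow_succ, eq_neg_of_add_eq_zero_right h4]; ring
      rw [← h2 (j - 1) (by omega), ← h1]
      push_cast; ring
    have hcinv : (c : ZMod p) = (j : ZMod p)⁻¹ * (-1) ^ (j - 1) := by
      rw [← hjc, inv_mul_cancel_left₀ hj0]
    have hsign : (-1 : ZMod p) ^ (p - j) * (-1) ^ (j - 1) = 1 := by
      rw [← pow_add, show p - j + (j - 1) = p - 1 by omega]
      exact (Nat.Odd.sub_odd hodd odd_one).neg_one_pow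
    have : (j : ZMod p)⁻¹ * (n : ZMod p) ^ j = ((n ^ j * (-1) ^ (p - j) * c : ℤ) : ZMod p) := by
      push_cast
      rw [hcinv]
      linear_combination (-((j : ZMod p)⁻¹ * (n : ZMod p) ^ j)) * hsign
    rw [this, mulP_intCast, hc]
    push_cast; ring
  have hsub : teichSq ((n : ZMod p) - 1) = ((n : ZMod (p ^ 2)) + (-1)) ^ p := by
    have := teichSq_intCast (p := p) (n - 1)
    push_cast at this
    rw [this, sub_eq_add_neg]
  have hsum : mulP ((truncLog p).eval (n : ZMod p)) =
      ∑ j ∈ Ico 1 p, mulP ((j : ZMod p)⁻¹ * (n : ZMod p) ^ j) := by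
    have hhom := map_sum (AddMonoidHom.mk' (mulP : ZMod p → ZMod (p ^ 2)) mulP_add)
      (fun j : ℕ => (j : ZMod p)⁻¹ * (n : ZMod p) ^ j) (Ico 1 p)
    simp only [AddMonoidHom.mk'_apply] at hhom
    rw [← hhom, truncLog, eval_finsetSum]
    simp
  rw [hsub, teichSq_intCast, hsum, ← Finset.sum_congr rfl hbin, add_pow, Finset.sum_range_succ,
    Finset.range_eq_Ico, Finset.sum_eq_sum_Ico_succ_bot (by omega)]
  simp only [pow_zero, Nat.sub_zero, hodd.neg_one_pow, Nat.choose_zero_right, Nat.sub_self,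
    Nat.choose_self, Nat.cast_one, zero_add]
  ring

/-- The unit of `ZMod (p ^ 2)` with residue `m` in the coset of the `p`-th powers labelled by `r`. -/
def unitOf (m r : ZMod p) : ZMod (p ^ 2) := teichSq m * (1 - mulP r)

lemma unitOf_eq (m r : ZMod p) : unitOf m r = teichSq m - mulP (m * r) := by
  rw [unitOf, mul_sub, mul_one, mul_mulP, redP_teichSq]

lemma redP_unitOf (m r : ZMod p) : redP (unitOf m r) = m := by
  rw [unitOf_eq, map_sub, redP_teichSq, redP_mulP, sub_zero]

lemma unitOf_injective {m r r' : ZMod p} (hm : m ≠ 0) (h : unitOf m r = unitOf m r') : r = r' := by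
  rw [unitOf_eq, unitOf_eq, sub_right_inj] at h
  exact mul_left_cancel₀ hm (mulP_injective h)

lemma exists_unitOf {z : ZMod (p ^ 2)} (hz : redP z ≠ 0) : ∃ r, z = unitOf (redP z) r := by
  obtain ⟨x, hx⟩ := exists_mulP_of_redP_eq_zero (z := z - teichSq (redP z))
    (by rw [map_sub, redP_teichSq, sub_self])
  refine ⟨-((redP z)⁻¹ * x), ?_⟩
  rw [unitOf_eq, mul_neg, mul_inv_cancel_left₀ hz, mulP_neg, ← hx]
  ring

/-- Summation over the units of `ZMod (p ^ 2)`. -/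
lemma sum_eq_sum_unitOf (H : ZMod (p ^ 2) → ℝ) (hH : ∀ z, redP z = 0 → H z = 0) :
    ∑ z, H z = ∑ m ∈ univ.erase (0 : ZMod p), ∑ r, H (unitOf m r) := by
  classical
  rw [← Finset.sum_product', ← Finset.sum_filter_ne_zero]
  symm
  rw [← Finset.sum_filter_ne_zero]
  refine Finset.sum_bij (fun q _ => unitOf q.1 q.2) ?_ ?_ ?_ ?_
  · intro q hq
    simpa using (mem_filter.1 hq).2
  · rintro ⟨m, r⟩ h1 ⟨m', r'⟩ _ h
    simp only [mem_filter, mem_product, mem_erase] at h1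
    have hm : m = m' := by simpa [redP_unitOf] using congrArg redP h
    subst hm
    exact Prod.ext rfl (unitOf_injective h1.1.1.1 h)
  · intro z hz
    have hz' : H z ≠ 0 := (mem_filter.1 hz).2
    have hred : redP z ≠ 0 := fun h => hz' (hH z h)
    obtain ⟨r, hr⟩ := exists_unitOf hred
    exact ⟨(redP z, r), by simp [hred, ← hr, hz'], hr.symm⟩
  · intro q _; rfl

/-- The indicator function of the `p`-th powers among the units of `ZMod (p ^ 2)`. -/
noncomputable def powInd (p : ℕ) [Fact p.Prime] (z : ZMod (p ^ 2)) : ℝ :=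
  if redP z ≠ 0 ∧ z = teichSq (redP z) then 1 else 0

lemma powInd_nonneg (z : ZMod (p ^ 2)) : 0 ≤ powInd p z := by
  unfold powInd; split_ifs <;> norm_num

lemma powInd_le_one (z : ZMod (p ^ 2)) : powInd p z ≤ 1 := by
  unfold powInd; split_ifs <;> norm_num

lemma powInd_unitOf {m : ZMod p} (hm : m ≠ 0) (r : ZMod p) :
    powInd p (unitOf m r) = if r = 0 then 1 else 0 := by
  unfold powInd
  rw [redP_unitOf]
  congr 1
  rw [unitOf_eq, sub_eq_self, mulP_eq_zero]
  simp [hm]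

lemma sum_powInd_mul (H : ZMod (p ^ 2) → ℝ) :
    ∑ z, powInd p z * H z = ∑ m ∈ univ.erase (0 : ZMod p), H (teichSq m) := by
  rw [sum_eq_sum_unitOf _ fun z hz => by simp [powInd, hz]]
  refine Finset.sum_congr rfl fun m hm => ?_
  rw [Finset.sum_eq_single 0]
  · rw [powInd_unitOf (ne_of_mem_erase hm), if_pos rfl, one_mul, unitOf_eq, mul_zero, mulP_zero,
      sub_zero]
  · intro r _ hr
    rw [powInd_unitOf (ne_of_mem_erase hm), if_neg hr, zero_mul]
  · simp

lemma card_erase_zero : (#(univ.erase (0 : ZMod p)) : ℝ) = (p : ℝ) - 1 := by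
  rw [card_erase_of_mem (mem_univ _), card_univ, ZMod.card,
    Nat.cast_sub (Fact.out : p.Prime).one_le, Nat.cast_one]

lemma sum_powInd : ∑ z, powInd p z = (p : ℝ) - 1 := by
  have := sum_powInd_mul (p := p) (fun _ => 1)
  simpa only [mul_one, sum_const, nsmul_eq_mul, card_erase_zero] using this

lemma autocorr_powInd_zero : autocorr (powInd p) 0 = (p : ℝ) - 1 := by
  rw [← sum_powInd, autocorr]
  refine Finset.sum_congr rfl fun y _ => ?_
  rw [add_zero]; unfold powInd; split_ifs <;> simp

lemma autocorr_powInd_of_redP_eq_zero {z : ZMod (p ^ 2)} (hz : redP z = 0) (h0 : z ≠ 0) :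
    autocorr (powInd p) z = 0 := by
  refine Finset.sum_eq_zero fun y _ => ?_
  unfold powInd
  rw [map_add, hz, add_zero]
  split_ifs with h1 h2
  · exact absurd (by simpa using h2.2.trans h1.2.symm) h0
  all_goals simp

/-- The number of representations of a unit as a difference of two `p`-th powers. -/
lemma autocorr_powInd_unitOf (hp : p ≠ 2) {m : ZMod p} (hm : m ≠ 0) (r : ZMod p) :
    autocorr (powInd p) (unitOf m r) = logCount r := by
  classical
  rw [autocorr, sum_powInd_mul, logCount, Finset.card_filter]
  push_cast
  -- the subtrahend is parametrized as the `p`-th power of `m * (k - 1)`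
  have h1 : ∀ k : ZMod p, teichSq (m * (k - 1)) + unitOf m r =
      unitOf (m * k) 0 + mulP (m * ((truncLog p).eval k - r)) := by
    intro k
    have h2 := teichSq_sub_teichSq_sub_one hp k
    have h3 : mulP (m * ((truncLog p).eval k - r)) =
        teichSq m * (mulP ((truncLog p).eval k)) - teichSq m * mulP r := by
      rw [mul_mulP, mul_mulP, ← mulP_sub, redP_teichSq]; ring_nf
    rw [h3, unitOf, unitOf, teichSq_mul, teichSq_mul, mulP_zero]
    linear_combination (-teichSq m) * h2
  have h4 : ∀ k : ZMod p, powInd p (teichSq (m * (k - 1)) + unitOf m r) =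
      if k ≠ 0 ∧ (truncLog p).eval k = r then 1 else 0 := by
    intro k
    rw [h1, powInd, map_add, redP_unitOf, redP_mulP, add_zero]
    refine if_congr ?_ rfl rfl
    rw [unitOf_eq, mul_zero, mulP_zero, sub_zero, add_eq_left, mulP_eq_zero]
    simp [hm, sub_eq_zero]
  rw [← Finset.sum_filter_add_sum_filter_not univ (fun k : ZMod p => k = 1)]
  rw [Finset.sum_eq_zero (s := {k : ZMod p | k = 1}) (by intro k hk; simp at hk; simp [hk]), zero_add]
  symm
  refine Finset.sum_bij (fun k _ => m * (k - 1)) ?_ ?_ ?_ ?_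
  · intro k hk
    simp only [mem_filter, mem_univ, true_and] at hk
    simp [hm, sub_eq_zero, hk]
  · intro k _ k' _ h
    simpa [hm] using h
  · intro y hy
    refine ⟨m⁻¹ * y + 1, ?_, ?_⟩
    · simpa [hm] using hy
    · simp [hm]
  · intro k hk
    simp only [mem_filter, mem_univ, true_and] at hk
    rw [h4]
    simp [hk]

/-- The function on `ZMod (p ^ 2)` that vanishes off the units and is `W` of the number of
representations as a difference of two `p`-th powers on the units. -/
noncomputable def unitFun (p : ℕ) [Fact p.Prime] (W : ℝ → ℝ) (z : ZMod (p ^ 2)) : ℝ :=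
  if redP z = 0 then 0 else W (autocorr (powInd p) z)

lemma unitFun_unitOf (hp : p ≠ 2) (W : ℝ → ℝ) {m : ZMod p} (hm : m ≠ 0) (r : ZMod p) :
    unitFun p W (unitOf m r) = W (logCount r) := by
  rw [unitFun, redP_unitOf, if_neg hm, autocorr_powInd_unitOf hp hm]

lemma unitFun_of_redP_eq_zero (W : ℝ → ℝ) {z : ZMod (p ^ 2)} (hz : redP z = 0) :
    unitFun p W z = 0 := if_pos hz

lemma unitFun_neg (W : ℝ → ℝ) (z : ZMod (p ^ 2)) : unitFun p W (-z) = unitFun p W z := by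
  simp [unitFun, autocorr_neg]

/-- Sums over the units against a function of the number of representations. -/
lemma sum_autocorr_mul_unitFun (hp : p ≠ 2) (Q : ℝ → ℝ → ℝ) (hQ : ∀ x, Q x 0 = 0) (W : ℝ → ℝ) :
    ∑ z, Q (autocorr (powInd p) z) (unitFun p W z) =
      ((p : ℝ) - 1) * ∑ r : ZMod p, Q (logCount r) (W (logCount r)) := by
  rw [sum_eq_sum_unitOf _ fun z hz => by rw [unitFun_of_redP_eq_zero W hz, hQ]]
  rw [Finset.sum_congr rfl fun m hm => Finset.sum_congr rfl fun r _ => by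
    rw [autocorr_powInd_unitOf hp (ne_of_mem_erase hm), unitFun_unitOf hp W (ne_of_mem_erase hm)]]
  rw [Finset.sum_const, nsmul_eq_mul, card_erase_zero]

/-- Moments of the number of representations of an element of `ZMod (p ^ 2)` as a difference of
two units that are `p`-th powers. -/
lemma sum_autocorr_powInd_pow (hp : p ≠ 2) {n : ℕ} (hn : n ≠ 0) :
    ∑ z, autocorr (powInd p) z ^ n =
      ((p : ℝ) - 1) ^ n + ((p : ℝ) - 1) * ∑ r : ZMod p, (logCount r : ℝ) ^ n := by
  have h := sum_autocorr_mul_unitFun hp (fun _ y => y ^ n) (by simp [hn]) id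
  simp only [id] at h
  rw [← h, ← Finset.add_sum_erase _ _ (mem_univ (0 : ZMod (p ^ 2))), autocorr_powInd_zero]
  congr 1
  rw [← Finset.add_sum_erase univ (fun z => unitFun p id z ^ n) (mem_univ (0 : ZMod (p ^ 2))),
    unitFun_of_redP_eq_zero _ (map_zero _), zero_pow hn, zero_add]
  refine Finset.sum_congr rfl fun z hz => ?_
  congr 1
  unfold unitFun
  split_ifs with h
  · exact autocorr_powInd_of_redP_eq_zero h (ne_of_mem_erase hz)
  · rfl

/-- The substitution `k = m' / (m' - m)`. -/
lemma sum_div_sub_eq {m : ZMod p} (hm : m ≠ 0) (Q : ZMod p → ℝ) :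
    ∑ m' ∈ univ.erase (0 : ZMod p), (if m' = m then 0 else Q (m' / (m' - m))) =
      ∑ k : ZMod p with k ≠ 0 ∧ k ≠ 1, Q k := by
  classical
  rw [Finset.sum_ite, Finset.sum_const_zero, zero_add]
  refine Finset.sum_bij' (fun m' _ => m' / (m' - m)) (fun k _ => k * m / (k - 1)) ?_ ?_ ?_ ?_ ?_
  · intro m' h
    simp only [mem_filter, mem_erase, mem_univ, and_true, true_and] at h ⊢
    have h1 : m' - m ≠ 0 := sub_ne_zero.2 h.2
    refine ⟨div_ne_zero h.1 h1, fun h2 => hm ?_⟩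
    rw [div_eq_one_iff_eq h1] at h2
    linear_combination h2
  · intro k h
    simp only [mem_filter, mem_erase, mem_univ, and_true, true_and] at h ⊢
    have h1 : k - 1 ≠ 0 := sub_ne_zero.2 h.2
    refine ⟨div_ne_zero (mul_ne_zero h.1 hm) h1, fun h2 => hm ?_⟩
    rw [div_eq_iff h1] at h2
    linear_combination h2
  · intro m' h
    simp only [mem_filter, mem_erase, mem_univ, and_true] at h
    have h1 : m' - m ≠ 0 := sub_ne_zero.2 h.2
    have h2 : m' / (m' - m) - 1 = m / (m' - m) := by field_simp; ring
    rw [h2]; field_simp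
  · intro k h
    simp only [mem_filter, mem_univ, true_and] at h
    have h1 : k - 1 ≠ 0 := sub_ne_zero.2 h.2
    have h2 : k * m / (k - 1) - m = m / (k - 1) := by field_simp; ring
    rw [h2]; field_simp
  · intro m' _; rfl

/-- The difference of two units, in coset coordinates. -/
lemma unitOf_sub_unitOf (hp : p ≠ 2) {m m' : ZMod p} (h : m' ≠ m) (r r' : ZMod p) :
    unitOf m' r' - unitOf m r = unitOf (m' - m) ((truncLog p).eval (m' / (m' - m)) +
      m' / (m' - m) * r' - (m' / (m' - m) - 1) * r) := by
  have h1 : m' - m ≠ 0 := sub_ne_zero.2 h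
  set d := m' - m with hd
  set k := m' / d with hk
  have e1 : m' = d * k := by rw [hk]; field_simp
  have e2 : m = d * (k - 1) := by rw [mul_sub, ← e1, hd]; ring
  have h2 := teichSq_sub_teichSq_sub_one hp k
  have h3 : mulP (d * ((truncLog p).eval k + k * r' - (k - 1) * r)) =
      teichSq d * mulP ((truncLog p).eval k) + mulP (m' * r') - mulP (m * r) := by
    rw [mul_mulP, ← mulP_add, ← mulP_sub, redP_teichSq, e2]
    congr 1
    rw [e1]; ring
  have h4 : teichSq m' - teichSq m = teichSq d * (1 - mulP ((truncLog p).eval k)) := by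
    rw [← h2, mul_sub, ← teichSq_mul, ← teichSq_mul, ← e1, ← e2]
  rw [unitOf_eq, unitOf_eq, unitOf_eq, h3]
  linear_combination h4

/-- The constant row sums, over the `p`-th powers, of a function of the number of
representations. -/
lemma sum_powInd_mul_unitFun_sub (hp : p ≠ 2) (W : ℝ → ℝ) {y : ZMod (p ^ 2)}
    (hy : powInd p y ≠ 0) :
    ∑ x, powInd p x * unitFun p W (x - y) = ∑ r : ZMod p, logCount r * W (logCount r) := by
  classical
  have hy' : redP y ≠ 0 ∧ y = teichSq (redP y) := by
    by_contra h; exact hy (if_neg h)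
  set m := redP y with hm
  rw [sum_powInd_mul, hy'.2]
  have h1 : ∀ m' : ZMod p, unitFun p W (teichSq m' - teichSq m) =
      if m' = m then 0 else W (logCount ((truncLog p).eval (m' / (m' - m)))) := by
    intro m'
    split_ifs with h
    · rw [h, sub_self]; exact unitFun_of_redP_eq_zero W (map_zero _)
    · have := unitOf_sub_unitOf hp h 0 0
      rw [unitOf_eq, unitOf_eq] at this
      simp only [mul_zero, mulP_zero, sub_zero, add_zero] at this
      rw [this, unitFun_unitOf hp W (sub_ne_zero.2 h)]
  rw [Finset.sum_congr rfl fun m' _ => h1 m',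
    sum_div_sub_eq hy'.1 fun k => W (logCount ((truncLog p).eval k)),
    ← Finset.sum_fiberwise_of_maps_to (g := fun k => (truncLog p).eval k) (t := univ) (by simp)]
  refine Finset.sum_congr rfl fun r _ => ?_
  rw [Finset.sum_congr rfl (g := fun _ => W (logCount r)) (by
    intro k hk; rw [(mem_filter.1 hk).2]), Finset.sum_const, nsmul_eq_mul, filter_filter]
  rw [logCount]
  simp only [and_assoc]

/-- An incidence bound of Vinogradov type, from the fact that two distinct pairs `(r, r')` agree
under `k r' - (k - 1) r` for at most one `k`. -/
lemma sum_incidence_le (c : ZMod p → ZMod p) (φ χ : ZMod p → ℝ) (hφ : ∀ r, 0 ≤ φ r) :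
    ∑ k : ZMod p with k ≠ 0 ∧ k ≠ 1, ∑ r, ∑ r', φ r * φ r' * χ (c k + k * r' - (k - 1) * r) ≤
      √((p * ∑ r, χ r ^ 2) * (p * (∑ r, φ r ^ 2) ^ 2 + (∑ r, φ r) ^ 4)) := by
  classical
  set S : Finset (ZMod p) := {k : ZMod p | k ≠ 0 ∧ k ≠ 1} with hS
  -- the weighted number of representations of `s` for a given `k`
  set ν : ZMod p → ZMod p → ℝ := fun k s =>
    ∑ q : ZMod p × ZMod p, if c k + k * q.2 - (k - 1) * q.1 = s then φ q.1 * φ q.2 else 0 with hν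
  refine Real.le_sqrt_of_sq_le ?_
  have h1 : ∑ k ∈ S, ∑ r, ∑ r', φ r * φ r' * χ (c k + k * r' - (k - 1) * r) =
      ∑ q ∈ S ×ˢ univ, χ q.2 * ν q.1 q.2 := by
    rw [Finset.sum_product]
    refine Finset.sum_congr rfl fun k _ => ?_
    simp only [hν, Finset.mul_sum]
    symm
    rw [Finset.sum_comm, Fintype.sum_prod_type]
    refine Finset.sum_congr rfl fun r _ => Finset.sum_congr rfl fun r' _ => ?_
    simp [mul_comm]
  have h2 : ∑ q ∈ S ×ˢ (univ : Finset (ZMod p)), χ q.2 ^ 2 ≤ p * ∑ r, χ r ^ 2 := by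
    rw [Finset.sum_product]
    dsimp only
    rw [Finset.sum_const, nsmul_eq_mul]
    refine mul_le_mul_of_nonneg_right ?_ (Finset.sum_nonneg fun _ _ => sq_nonneg _)
    exact_mod_cast (card_le_univ S).trans (by rw [ZMod.card])
  have h3 : ∑ q ∈ S ×ˢ (univ : Finset (ZMod p)), ν q.1 q.2 ^ 2 ≤
      p * (∑ r, φ r ^ 2) ^ 2 + (∑ r, φ r) ^ 4 := by
    have e1 : ∀ k, ∑ s, ν k s ^ 2 = ∑ q : ZMod p × ZMod p, ∑ q' : ZMod p × ZMod p,
        if c k + k * q.2 - (k - 1) * q.1 = c k + k * q'.2 - (k - 1) * q'.1 then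
          φ q.1 * φ q.2 * (φ q'.1 * φ q'.2) else 0 := by
      intro k
      simp only [hν, sq, Finset.sum_mul_sum]
      rw [Finset.sum_comm]
      refine Finset.sum_congr rfl fun q _ => ?_
      rw [Finset.sum_comm]
      refine Finset.sum_congr rfl fun q' _ => ?_
      rw [Finset.sum_eq_single (c k + k * q.2 - (k - 1) * q.1)]
      · rw [if_pos rfl]
        by_cases h : c k + k * q.2 - (k - 1) * q.1 = c k + k * q'.2 - (k - 1) * q'.1
        · rw [if_pos h, if_pos h.symm]
        · rw [if_neg h, if_neg (fun h' => h h'.symm), mul_zero]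
      · intro s _ hs; rw [if_neg (fun h => hs h.symm), zero_mul]
      · simp
    -- distinct pairs `q`, `q'` are compatible for at most one `k`
    have e2 : ∀ q q' : ZMod p × ZMod p, (∑ k ∈ S,
        if c k + k * q.2 - (k - 1) * q.1 = c k + k * q'.2 - (k - 1) * q'.1 then
          φ q.1 * φ q.2 * (φ q'.1 * φ q'.2) else 0) ≤
        (if q' = q then p * (φ q.1 ^ 2 * φ q.2 ^ 2) else 0) +
          φ q.1 * φ q.2 * (φ q'.1 * φ q'.2) := by
      intro q q'
      have hpos : 0 ≤ φ q.1 * φ q.2 * (φ q'.1 * φ q'.2) :=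
        mul_nonneg (mul_nonneg (hφ _) (hφ _)) (mul_nonneg (hφ _) (hφ _))
      rw [← Finset.sum_filter, Finset.sum_const, nsmul_eq_mul]
      split_ifs with h
      · subst h
        have : (#{k ∈ S | c k + k * q'.2 - (k - 1) * q'.1 = c k + k * q'.2 - (k - 1) * q'.1} : ℝ)
            ≤ p := by exact_mod_cast (card_le_univ _).trans (by rw [ZMod.card])
        nlinarith
      · rw [zero_add]
        refine mul_le_of_le_one_left hpos ?_
        have : #{k ∈ S | c k + k * q.2 - (k - 1) * q.1 = c k + k * q'.2 - (k - 1) * q'.1} ≤ 1 := by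
          rw [Finset.card_le_one]
          intro k hk k' hk'
          simp only [mem_filter] at hk hk'
          have l1 : k * ((q.2 - q'.2) - (q.1 - q'.1)) = -(q.1 - q'.1) := by
            linear_combination hk.2
          have l2 : k' * ((q.2 - q'.2) - (q.1 - q'.1)) = -(q.1 - q'.1) := by
            linear_combination hk'.2
          by_contra hne
          have l3 : (k - k') * ((q.2 - q'.2) - (q.1 - q'.1)) = 0 := by
            linear_combination l1 - l2
          have l4 := (mul_eq_zero.1 l3).resolve_left (sub_ne_zero.2 hne)
          rw [l4, mul_zero] at l1
          refine h (Prod.ext ?_ ?_)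
          · linear_combination -l1
          · linear_combination -l1 - l4
        exact_mod_cast this
    rw [Finset.sum_product, Finset.sum_congr rfl fun k _ => e1 k, Finset.sum_comm,
      Finset.sum_congr rfl fun q _ => Finset.sum_comm]
    refine (Finset.sum_le_sum fun q _ => Finset.sum_le_sum fun q' _ => e2 q q').trans (le_of_eq ?_)
    simp only [Finset.sum_add_distrib, ← Finset.mul_sum, ← Finset.sum_mul, Finset.sum_ite_eq',
      mem_univ, if_true]
    have e3 : ∑ q : ZMod p × ZMod p, φ q.1 * φ q.2 = (∑ r, φ r) ^ 2 := by
      rw [Fintype.sum_prod_type, sq, Finset.sum_mul_sum]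
    have e4 : ∑ q : ZMod p × ZMod p, φ q.1 ^ 2 * φ q.2 ^ 2 = (∑ r, φ r ^ 2) ^ 2 := by
      rw [Fintype.sum_prod_type, sq (∑ r, φ r ^ 2), Finset.sum_mul_sum]
    rw [e3, e4]
    ring
  rw [h1]
  refine (Finset.sum_mul_sq_le_sq_mul_sq _ _ _).trans ?_
  exact mul_le_mul h2 h3 (Finset.sum_nonneg fun _ _ => sq_nonneg _)
    (mul_nonneg (Nat.cast_nonneg _) (Finset.sum_nonneg fun _ _ => sq_nonneg _))

/-- The sum over triples of units with `β - α` a unit, for weights that depend only on the number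
of representations. -/
lemma sum_unitFun_triple_le (hp : p ≠ 2) (W V : ℝ → ℝ) :
    ∑ α, ∑ β, unitFun p W α ^ 2 * unitFun p W β ^ 2 * unitFun p V (β - α) ^ 2 ≤
      ((p : ℝ) - 1) * √((p * ∑ r : ZMod p, V (logCount r) ^ 4) *
        (p * (∑ r : ZMod p, W (logCount r) ^ 4) ^ 2 + (∑ r : ZMod p, W (logCount r) ^ 2) ^ 4)) := by
  classical
  rw [sum_eq_sum_unitOf _ fun α hα => Finset.sum_eq_zero fun β _ => by
    rw [unitFun_of_redP_eq_zero W hα]; ring]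
  rw [Finset.sum_congr rfl fun m hm => Finset.sum_congr rfl fun r _ => by
    rw [sum_eq_sum_unitOf _ fun β hβ => by rw [unitFun_of_redP_eq_zero W hβ]; ring]]
  have h1 : ∀ m ∈ univ.erase (0 : ZMod p),
      ∑ r, ∑ m' ∈ univ.erase (0 : ZMod p), ∑ r', unitFun p W (unitOf m r) ^ 2 *
        unitFun p W (unitOf m' r') ^ 2 * unitFun p V (unitOf m' r' - unitOf m r) ^ 2 =
      ∑ k : ZMod p with k ≠ 0 ∧ k ≠ 1, ∑ r, ∑ r', W (logCount r) ^ 2 * W (logCount r') ^ 2 *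
        V (logCount ((truncLog p).eval k + k * r' - (k - 1) * r)) ^ 2 := by
    intro m hm
    rw [Finset.sum_comm, ← sum_div_sub_eq (ne_of_mem_erase hm)]
    refine Finset.sum_congr rfl fun m' hm' => ?_
    split_ifs with h
    · refine Finset.sum_eq_zero fun r _ => Finset.sum_eq_zero fun r' _ => ?_
      rw [unitFun_of_redP_eq_zero V (by rw [map_sub, redP_unitOf, redP_unitOf, h, sub_self])]
      ring
    · refine Finset.sum_congr rfl fun r _ => Finset.sum_congr rfl fun r' _ => ?_
      rw [unitOf_sub_unitOf hp h, unitFun_unitOf hp W (ne_of_mem_erase hm),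
        unitFun_unitOf hp W (ne_of_mem_erase hm'), unitFun_unitOf hp V (sub_ne_zero.2 h)]
  rw [Finset.sum_congr rfl h1, Finset.sum_const, nsmul_eq_mul, card_erase_zero]
  have hp1 : (0 : ℝ) ≤ (p : ℝ) - 1 := by
    have : (1 : ℝ) ≤ p := by exact_mod_cast (Fact.out : p.Prime).one_le
    linarith
  refine mul_le_mul_of_nonneg_left ?_ hp1
  refine (sum_incidence_le (fun k : ZMod p => (truncLog p).eval k) (fun r => W (logCount r) ^ 2)
    (fun r => V (logCount r) ^ 2) fun r => sq_nonneg _).trans (le_of_eq ?_)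
  simp only [← pow_mul]

end Teichmuller

/-! ### The energy bound -/

section Energy

open Finset

/-- The optimisation of the truncation parameters: from the energy inequality, in which `Y` and `Z`
are the second and third moments, to a bound for `Y`. -/
lemma pow_seventeen_le_of_energy {c q L Y Z β τ τ₁ : ℝ} (hc : 1 ≤ c) (hq : 1 ≤ q) (hL : 1 ≤ L)
    (hY : 0 < Y) (hZ0 : 0 ≤ Z) (hZ : Z ≤ c * q ^ 2 * L) (hY2 : Y ^ 2 ≤ 4 * c ^ 2 * q ^ 3)
    (hτ : τ = 8 * c ^ 2 * q ^ 5 * L / Y ^ 3) (hτ₁ : τ₁ = 2 * c * q ^ 2 / Y)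
    (hβ : β ≤ c * q ^ 2 / τ)
    (h : Y ^ 3 / 4 ≤ (q + β) * (q * Z) + √((q ^ 3 + q * Z) * (q *
      √((q * (τ * Z)) * (q * (τ₁ * Z) ^ 2 + Y ^ 4))))) :
    Y ^ 17 ≤ 512 ^ 2 * 544 * c ^ 11 * q ^ 25 * L ^ 10 := by
  have hc0 : 0 < c := by linarith
  have hq0 : 0 < q := by linarith
  have hL0 : 0 < L := by linarith
  have hτ0 : 0 < τ := by rw [hτ]; positivity
  have hτ₁0 : 0 < τ₁ := by rw [hτ₁]; positivity
  have hL610 : L ^ 6 ≤ L ^ 10 := pow_le_pow_right₀ hL (by norm_num)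
  -- `τ` is chosen so that the large values take up at most half of the left side
  have hβZ : β * (q * Z) ≤ Y ^ 3 / 8 := by
    calc β * (q * Z) ≤ (c * q ^ 2 / τ) * (q * (c * q ^ 2 * L)) := by gcongr
      _ = Y ^ 3 / 8 := by rw [hτ]; field_simp
  set X := (q * (τ * Z)) * (q * (τ₁ * Z) ^ 2 + Y ^ 4) with hX
  have hX0 : 0 ≤ X := by positivity
  rcases le_or_gt (Y ^ 3 / 16) (q * (q * Z)) with h1 | h1
  · -- the diagonal term dominates
    have h2 : Y ^ 3 ≤ 16 * c * q ^ 4 * L := by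
      have : q * (q * Z) ≤ q * (q * (c * q ^ 2 * L)) := by gcongr
      nlinarith
    calc Y ^ 17 = (Y ^ 3) ^ 5 * Y ^ 2 := by ring
      _ ≤ (16 * c * q ^ 4 * L) ^ 5 * (4 * c ^ 2 * q ^ 3) := by gcongr
      _ = 16 ^ 5 * 4 * (c ^ 7 * q ^ 23 * L ^ 5) := by ring
      _ ≤ 16 ^ 5 * 4 * (c ^ 11 * q ^ 25 * L ^ 10) := by gcongr <;> first | assumption | norm_num
      _ ≤ 512 ^ 2 * 544 * (c ^ 11 * q ^ 25 * L ^ 10) := by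
          gcongr ?_ * _
          norm_num
      _ = _ := by ring
  · -- the Cauchy–Schwarz term dominates
    have h2 : Y ^ 3 / 16 ≤ √((q ^ 3 + q * Z) * (q * √X)) := by nlinarith
    have h3 : (Y ^ 3 / 16) ^ 2 ≤ (q ^ 3 + q * Z) * (q * √X) := by
      rw [← Real.le_sqrt' (by positivity)]; exact h2
    have h4 : (q ^ 3 + q * Z) * q ≤ 2 * c * q ^ 4 * L := by
      have e1 : q * Z ≤ q * (c * q ^ 2 * L) := by gcongr
      have e2 : q ^ 3 * 1 ≤ q ^ 3 * (c * L) := by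
        gcongr; nlinarith
      calc (q ^ 3 + q * Z) * q ≤ (q ^ 3 * (c * L) + q * (c * q ^ 2 * L)) * q := by
            gcongr; linarith
        _ = _ := by ring
    have h5 : Y ^ 6 / (512 * c * q ^ 4 * L) ≤ √X := by
      rw [div_le_iff₀ (by positivity)]
      have : (q ^ 3 + q * Z) * q * √X ≤ 2 * c * q ^ 4 * L * √X := by gcongr
      nlinarith
    have h6 : (Y ^ 6 / (512 * c * q ^ 4 * L)) ^ 2 ≤ X := by
      rw [← Real.le_sqrt' (by positivity)]; exact h5
    have h7 : q * (τ * Z) ≤ 8 * c ^ 3 * q ^ 8 * L ^ 2 / Y ^ 3 := by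
      calc q * (τ * Z) ≤ q * (τ * (c * q ^ 2 * L)) := by gcongr
        _ = _ := by rw [hτ]; field_simp
    have h8 : q * (τ₁ * Z) ^ 2 ≤ 4 * c ^ 6 * q ^ 9 * L ^ 2 / Y ^ 2 := by
      calc q * (τ₁ * Z) ^ 2 ≤ q * (τ₁ * (c * q ^ 2 * L)) ^ 2 := by gcongr
        _ = 4 * c ^ 4 * q ^ 9 * L ^ 2 / Y ^ 2 := by rw [hτ₁]; field_simp; ring
        _ ≤ _ := by gcongr ; first | assumption | norm_num
    have h9 : Y ^ 4 ≤ 64 * c ^ 6 * q ^ 9 * L ^ 2 / Y ^ 2 := by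
      rw [le_div_iff₀ (by positivity)]
      calc Y ^ 4 * Y ^ 2 = (Y ^ 2) ^ 3 := by ring
        _ ≤ (4 * c ^ 2 * q ^ 3) ^ 3 := by gcongr
        _ = 64 * c ^ 6 * q ^ 9 * 1 := by ring
        _ ≤ 64 * c ^ 6 * q ^ 9 * L ^ 2 := by gcongr; exact one_le_pow₀ hL
    have h10 : X ≤ (8 * c ^ 3 * q ^ 8 * L ^ 2 / Y ^ 3) *
        (4 * c ^ 6 * q ^ 9 * L ^ 2 / Y ^ 2 + 64 * c ^ 6 * q ^ 9 * L ^ 2 / Y ^ 2) := by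
      rw [hX]; gcongr
    have h11 := h6.trans h10
    have h12 : (Y ^ 6 / (512 * c * q ^ 4 * L)) ^ 2 = Y ^ 17 / (512 ^ 2 * c ^ 2 * q ^ 8 * L ^ 2) / Y ^ 5 := by
      field_simp
    have h13 : (8 * c ^ 3 * q ^ 8 * L ^ 2 / Y ^ 3) *
        (4 * c ^ 6 * q ^ 9 * L ^ 2 / Y ^ 2 + 64 * c ^ 6 * q ^ 9 * L ^ 2 / Y ^ 2) =
        (544 * c ^ 9 * q ^ 17 * L ^ 4) / Y ^ 5 := by
      field_simp; ring
    rw [h12, h13, div_le_div_iff_of_pos_right (by positivity), div_le_iff₀ (by positivity)] at h11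
    calc Y ^ 17 ≤ 544 * c ^ 9 * q ^ 17 * L ^ 4 * (512 ^ 2 * c ^ 2 * q ^ 8 * L ^ 2) := h11
      _ = 512 ^ 2 * 544 * c ^ 11 * q ^ 25 * L ^ 6 := by ring
      _ ≤ _ := by gcongr

variable {p : ℕ} [Fact p.Prime]

lemma logCount_decay (hp8 : 8 ≤ p) (t : ℕ) :
    (t : ℝ) ^ 3 * #{r : ZMod p | t ≤ logCount r} ≤ 2 ^ 17 * (p : ℝ) ^ 2 := by
  exact_mod_cast pow_three_mul_card_le hp8 t

lemma logCount_le (r : ZMod p) : logCount r ≤ p :=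
  (card_le_univ _).trans (by rw [ZMod.card])

/-- The Heath-Brown–Konyagin bound for the second moment. -/
lemma sq_sum_logCount_sq_le (hp8 : 8 ≤ p) :
    (∑ r : ZMod p, (logCount r : ℝ) ^ 2) ^ 2 ≤ 4 * (3 * 2 ^ 17) ^ 2 * (p : ℝ) ^ 3 := by
  have hp0 : (0 : ℝ) < p := by exact_mod_cast (by omega : 0 < p)
  have hs0 : 0 < √(p : ℝ) := Real.sqrt_pos.2 hp0
  have hs : √(p : ℝ) ^ 2 = p := Real.sq_sqrt hp0.le
  have h1 := sum_sq_filter_le_of_decay (logCount_decay hp8) hs0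
  have h2 : ∑ r : ZMod p with ¬ √(p : ℝ) < logCount r, (logCount r : ℝ) ^ 2 ≤ √p * p := by
    calc ∑ r : ZMod p with ¬ √(p : ℝ) < logCount r, (logCount r : ℝ) ^ 2
        ≤ ∑ r : ZMod p with ¬ √(p : ℝ) < logCount r, √p * (logCount r : ℝ) := by
          refine Finset.sum_le_sum fun r hr => ?_
          rw [sq]
          exact mul_le_mul_of_nonneg_right (not_lt.1 (mem_filter.1 hr).2) (Nat.cast_nonneg _)
      _ ≤ √p * p := by
          rw [← Finset.mul_sum]
          refine mul_le_mul_of_nonneg_left ?_ hs0.le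
          exact_mod_cast sum_logCount_le _
  have h3 : 3 * (2 ^ 17 * (p : ℝ) ^ 2) / √p = 3 * 2 ^ 17 * (√p * p) := by
    rw [div_eq_iff hs0.ne']
    linear_combination (-(3 * 2 ^ 17 * (p : ℝ))) * hs
  rw [h3] at h1
  have h4 := Finset.sum_filter_add_sum_filter_not univ
    (fun r : ZMod p => √(p : ℝ) < logCount r) (fun r => (logCount r : ℝ) ^ 2)
  have h5 : ∑ r : ZMod p, (logCount r : ℝ) ^ 2 ≤ 2 * (3 * 2 ^ 17) * (√p * p) := by
    have : 0 ≤ √(p : ℝ) * p := by positivity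
    linarith
  calc (∑ r : ZMod p, (logCount r : ℝ) ^ 2) ^ 2 ≤ (2 * (3 * 2 ^ 17) * (√p * p)) ^ 2 := by
        gcongr
    _ = 4 * (3 * 2 ^ 17) ^ 2 * (p : ℝ) ^ 3 := by
        linear_combination (4 * (3 * 2 ^ 17) ^ 2 * (p : ℝ) ^ 2) * hs

/-- The bound for the second moment of `logCount`. -/
theorem sum_logCount_sq_pow_le (hp8 : 8 ≤ p) :
    (∑ r : ZMod p, (logCount r : ℝ) ^ 2) ^ 17 ≤
      512 ^ 2 * 544 * (3 * 2 ^ 17) ^ 11 * (p : ℝ) ^ 25 * (1 + Real.log p) ^ 10 := by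
  have hp1 : (1 : ℝ) ≤ p := by exact_mod_cast (by omega : 1 ≤ p)
  have hlog : 0 ≤ Real.log p := Real.log_nonneg hp1
  have hp2 : p ≠ 2 := by omega
  set q : ℝ := (p : ℝ) with hq
  set L : ℝ := 1 + Real.log q with hL
  set c : ℝ := 3 * 2 ^ 17 with hc
  set Y : ℝ := ∑ r : ZMod p, (logCount r : ℝ) ^ 2 with hYdef
  set Z : ℝ := ∑ r : ZMod p, (logCount r : ℝ) ^ 3 with hZdef
  have hY0 : 0 ≤ Y := Finset.sum_nonneg fun _ _ => sq_nonneg _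
  rcases hY0.eq_or_lt with hY | hY
  · have : 0 ≤ L := by linarith
    rw [← hY, zero_pow (by norm_num)]; positivity
  have hZ0 : 0 ≤ Z := Finset.sum_nonneg fun _ _ => by positivity
  have hZ : Z ≤ c * q ^ 2 * L := by
    have := sum_pow_three_le_of_decay (logCount_decay hp8) (n := p) logCount_le
    rw [hc, hZdef]; linarith
  have hY2 : Y ^ 2 ≤ 4 * c ^ 2 * q ^ 3 := sq_sum_logCount_sq_le hp8
  set τ : ℝ := 8 * c ^ 2 * q ^ 5 * L / Y ^ 3 with hτ
  set τ₁ : ℝ := 2 * c * q ^ 2 / Y with hτ₁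
  have hq0 : 0 < q := by linarith
  have hL0 : 0 < L := by linarith
  have hc0 : 0 < c := by norm_num [hc]
  have hτ0 : 0 < τ := by positivity
  have hτ₁0 : 0 < τ₁ := by positivity
  -- truncations of the number of representations: `W` at `τ₁`, `V` at `τ`, and `B` above `τ`
  set W : ℝ → ℝ := fun x => if x ≤ τ₁ then x else 0 with hW
  set V : ℝ → ℝ := fun x => if x ≤ τ then x else 0 with hV
  set B : ℝ → ℝ := fun x => if τ < x then x else 0 with hB
  set μ : ℝ := ∑ r : ZMod p, logCount r * W (logCount r) with hμ
  set β : ℝ := ∑ r : ZMod p, logCount r * B (logCount r) with hβ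
  have hWle : ∀ x : ℝ, 0 ≤ x → 0 ≤ W x ∧ W x ≤ x ∧ W x ≤ τ₁ := by
    intro x hx; simp only [hW]; split_ifs with h
    · exact ⟨hx, le_rfl, h⟩
    · exact ⟨le_rfl, hx, hτ₁0.le⟩
  have hVle : ∀ x : ℝ, 0 ≤ x → 0 ≤ V x ∧ V x ≤ x ∧ V x ≤ τ := by
    intro x hx; simp only [hV]; split_ifs with h
    · exact ⟨hx, le_rfl, h⟩
    · exact ⟨le_rfl, hx, hτ0.le⟩
  have hg0 : ∀ z, 0 ≤ autocorr (powInd p) z := fun z =>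
    Finset.sum_nonneg fun y _ => mul_nonneg (powInd_nonneg _) (powInd_nonneg _)
  have hβle : β ≤ c * q ^ 2 / τ := by
    have h1 := sum_sq_filter_le_of_decay (logCount_decay hp8) hτ0
    have h2 : β = ∑ r : ZMod p with τ < logCount r, (logCount r : ℝ) ^ 2 := by
      rw [hβ, Finset.sum_filter]
      refine Finset.sum_congr rfl fun r _ => ?_
      simp only [hB]; split_ifs <;> ring
    rw [h2]; refine h1.trans (le_of_eq ?_); rw [hc]; ring
  -- the truncation at `τ₁` keeps half of the second moment
  have hμle : Y / 2 ≤ μ := by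
    have h1 := sum_sq_filter_le_of_decay (logCount_decay hp8) hτ₁0
    have h2 : 3 * (2 ^ 17 * (p : ℝ) ^ 2) / τ₁ = Y / 2 := by
      rw [hτ₁, hc, ← hq]; field_simp
    have h3 : μ = ∑ r : ZMod p with ¬ τ₁ < logCount r, (logCount r : ℝ) ^ 2 := by
      rw [hμ, Finset.sum_filter]
      refine Finset.sum_congr rfl fun r _ => ?_
      simp only [hW, not_lt]; split_ifs <;> ring
    have h4 := Finset.sum_filter_add_sum_filter_not univ
      (fun r : ZMod p => τ₁ < logCount r) (fun r => (logCount r : ℝ) ^ 2)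
    rw [h2] at h1
    linarith
  have hen := sq_mul_energy_le (powInd p) (unitFun p W) (unitFun p V) (unitFun p B) powInd_nonneg
    (P := q - 1) (μ := μ) (β := β) sum_powInd
    (fun y hy => sum_powInd_mul_unitFun_sub hp2 W hy)
    (fun s => by
      unfold unitFun; split_ifs
      · exact le_rfl
      · simp only [hB]; split_ifs
        · exact hg0 s
        · exact le_rfl)
    (unitFun_neg B) (fun y hy => sum_powInd_mul_unitFun_sub hp2 B hy) powInd_le_one
    (fun s hs => by
      unfold unitFun; split_ifs with h
      · rw [autocorr_powInd_of_redP_eq_zero h hs]; simp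
      · simp only [hV, hB]
        rcases le_or_gt (autocorr (powInd p) s) τ with h' | h'
        · simp [h', not_lt.2 h']
        · simp [h', not_le.2 h'])
    autocorr_powInd_zero.le
    (by rw [unitFun_of_redP_eq_zero _ (map_zero _)])
    (fun s => by
      unfold unitFun; split_ifs
      · exact le_rfl
      · exact (hWle _ (hg0 s)).1)
  have hP : 0 < q - 1 := by
    have : (8 : ℝ) ≤ q := by rw [hq]; exact_mod_cast hp8
    linarith
  have hgw : ∑ s, autocorr (powInd p) s * unitFun p W s ^ 2 ≤ q * Z := by
    rw [sum_autocorr_mul_unitFun hp2 (fun x y => x * y ^ 2) (by simp) W]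
    refine mul_le_mul (by linarith) (Finset.sum_le_sum fun r _ => ?_)
      (Finset.sum_nonneg fun r _ => by positivity) hq0.le
    have h1 := hWle (logCount r) (Nat.cast_nonneg _)
    calc (logCount r : ℝ) * W (logCount r) ^ 2 ≤ logCount r * (logCount r : ℝ) ^ 2 := by
          have := pow_le_pow_left₀ h1.1 h1.2.1 2
          gcongr
      _ = _ := by ring
  have hg3 : ∑ s, autocorr (powInd p) s ^ 3 ≤ q ^ 3 + q * Z := by
    rw [sum_autocorr_powInd_pow hp2 (by norm_num)]
    have h1 : (q - 1) ^ 3 ≤ q ^ 3 := pow_le_pow_left₀ hP.le (by linarith) 3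
    have h2 : (q - 1) * Z ≤ q * Z := by nlinarith
    linarith
  have hV4 : ∑ r : ZMod p, V (logCount r) ^ 4 ≤ τ * Z := by
    rw [hZdef, Finset.mul_sum]
    refine Finset.sum_le_sum fun r _ => ?_
    have h1 := hVle (logCount r) (Nat.cast_nonneg _)
    rw [pow_succ']
    exact mul_le_mul h1.2.2 (pow_le_pow_left₀ h1.1 h1.2.1 3) (pow_nonneg h1.1 3) hτ0.le
  have hW4 : ∑ r : ZMod p, W (logCount r) ^ 4 ≤ τ₁ * Z := by
    rw [hZdef, Finset.mul_sum]
    refine Finset.sum_le_sum fun r _ => ?_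
    have h1 := hWle (logCount r) (Nat.cast_nonneg _)
    rw [pow_succ']
    exact mul_le_mul h1.2.2 (pow_le_pow_left₀ h1.1 h1.2.1 3) (pow_nonneg h1.1 3) hτ₁0.le
  have hW2 : ∑ r : ZMod p, W (logCount r) ^ 2 ≤ Y := by
    refine Finset.sum_le_sum fun r _ => ?_
    have h1 := hWle (logCount r) (Nat.cast_nonneg _)
    exact pow_le_pow_left₀ h1.1 h1.2.1 2
  have hV40 : 0 ≤ ∑ r : ZMod p, V (logCount r) ^ 4 := Finset.sum_nonneg fun _ _ => by positivity
  have hW40 : 0 ≤ ∑ r : ZMod p, W (logCount r) ^ 4 := Finset.sum_nonneg fun _ _ => by positivity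
  have hW20 : 0 ≤ ∑ r : ZMod p, W (logCount r) ^ 2 := Finset.sum_nonneg fun _ _ => by positivity
  have htri : ∑ α, ∑ β, unitFun p W α ^ 2 * unitFun p W β ^ 2 * unitFun p V (β - α) ^ 2 ≤
      q * √((q * (τ * Z)) * (q * (τ₁ * Z) ^ 2 + Y ^ 4)) := by
    refine (sum_unitFun_triple_le hp2 W V).trans ?_
    refine mul_le_mul (by linarith) (Real.sqrt_le_sqrt ?_) (Real.sqrt_nonneg _) hq0.le
    gcongr
  have hE : (q - 1) * Y ≤ ∑ s, autocorr (powInd p) s ^ 2 := by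
    rw [sum_autocorr_powInd_pow hp2 (by norm_num)]
    nlinarith
  refine pow_seventeen_le_of_energy (by norm_num [hc]) hp1 (by linarith) hY hZ0 hZ hY2 hτ hτ₁ hβle ?_
  have hβ0 : 0 ≤ β := Finset.sum_nonneg fun r _ => by
    simp only [hB]; split_ifs <;> positivity
  have h1 : (Y / 2) ^ 2 * ((q - 1) * Y) ≤ μ ^ 2 * ∑ s, autocorr (powInd p) s ^ 2 := by
    gcongr
  have h2 : (q - 1) * (Y ^ 3 / 4) ≤ (q - 1) * ((q - 1 + β) *
      ∑ s, autocorr (powInd p) s * unitFun p W s ^ 2 +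
      √((∑ s, autocorr (powInd p) s ^ 3) *
        ∑ α, ∑ β, unitFun p W α ^ 2 * unitFun p W β ^ 2 * unitFun p V (β - α) ^ 2)) := by
    refine le_trans (le_of_eq ?_) (h1.trans hen)
    ring
  refine (le_of_mul_le_mul_left h2 hP).trans ?_
  have hs0 : 0 ≤ ∑ s, autocorr (powInd p) s * unitFun p W s ^ 2 :=
    Finset.sum_nonneg fun s _ => mul_nonneg (hg0 s) (sq_nonneg _)
  have ht0 : 0 ≤ ∑ α, ∑ β, unitFun p W α ^ 2 * unitFun p W β ^ 2 * unitFun p V (β - α) ^ 2 :=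
    Finset.sum_nonneg fun s _ => Finset.sum_nonneg fun t _ => by positivity
  refine add_le_add ?_ (Real.sqrt_le_sqrt ?_)
  · exact mul_le_mul (by linarith) hgw hs0 (by linarith)
  · exact mul_le_mul hg3 htri ht0 (add_nonneg (pow_nonneg hq0.le 3) (mul_nonneg hq0.le hZ0))

/-- The additive energy of the `p`-th powers modulo `p ^ 2`. -/
theorem exists_energy_le : ∃ C : ℝ, 1 ≤ C ∧ ∀ (p : ℕ) [Fact p.Prime], 8 ≤ p →
    ∑ s, autocorr (powInd p) s ^ 2 ≤
      C * (p : ℝ) ^ (42 / 17 : ℝ) * Real.logb 2 p ^ (10 / 17 : ℝ) := by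
  set D : ℝ := 512 ^ 2 * 544 * (3 * 2 ^ 17) ^ 11 * 2 ^ 10 with hD
  have hD0 : 0 < D := by norm_num [hD]
  refine ⟨1 + D ^ (1 / 17 : ℝ), by have := Real.rpow_nonneg hD0.le (1 / 17); linarith, ?_⟩
  intro p _ hp8
  have hp8' : (8 : ℝ) ≤ p := by exact_mod_cast hp8
  have hp0 : (0 : ℝ) < p := by linarith
  have hl1 : 1 ≤ Real.logb 2 p := by
    rw [Real.le_logb_iff_rpow_le (by norm_num) hp0]; norm_num; linarith
  have hlog : 1 + Real.log p ≤ 2 * Real.logb 2 p := by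
    have h1 : Real.log p = Real.logb 2 p * Real.log 2 := by
      rw [Real.logb, div_mul_cancel₀ _ (Real.log_pos (by norm_num)).ne']
    have h2 : Real.log 2 ≤ 1 := by linarith [Real.log_two_lt_d9]
    rw [h1]
    nlinarith
  have hlog0 : 0 ≤ 1 + Real.log p := by
    have := Real.log_nonneg (by linarith : (1 : ℝ) ≤ p); linarith
  set Y : ℝ := ∑ r : ZMod p, (logCount r : ℝ) ^ 2 with hY
  set l := Real.logb 2 p with hl
  have hY0 : 0 ≤ Y := Finset.sum_nonneg fun _ _ => sq_nonneg _
  have hl0 : 0 ≤ l := by linarith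
  have h17 : Y ^ 17 ≤ D * (p : ℝ) ^ 25 * l ^ 10 := by
    refine (sum_logCount_sq_pow_le hp8).trans ?_
    calc 512 ^ 2 * 544 * (3 * 2 ^ 17) ^ 11 * (p : ℝ) ^ 25 * (1 + Real.log p) ^ 10
        ≤ 512 ^ 2 * 544 * (3 * 2 ^ 17) ^ 11 * (p : ℝ) ^ 25 * (2 * l) ^ 10 := by gcongr
      _ = _ := by rw [hD]; ring
  have hYle : Y ≤ D ^ (1 / 17 : ℝ) * (p : ℝ) ^ (25 / 17 : ℝ) * l ^ (10 / 17 : ℝ) := by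
    have h1 : Y = (Y ^ 17) ^ (1 / 17 : ℝ) := by
      rw [← Real.rpow_natCast, ← Real.rpow_mul hY0]; norm_num
    rw [h1]
    refine (Real.rpow_le_rpow (by positivity) h17 (by norm_num)).trans (le_of_eq ?_)
    rw [Real.mul_rpow (by positivity) (by positivity), Real.mul_rpow hD0.le (by positivity),
      ← Real.rpow_natCast (p : ℝ), ← Real.rpow_natCast l, ← Real.rpow_mul hp0.le,
      ← Real.rpow_mul hl0]
    norm_num
  rw [sum_autocorr_powInd_pow (by omega) (by norm_num), ← hY]
  have h2 : ((p : ℝ) - 1) ^ 2 ≤ (p : ℝ) ^ (42 / 17 : ℝ) * l ^ (10 / 17 : ℝ) := by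
    calc ((p : ℝ) - 1) ^ 2 ≤ (p : ℝ) ^ 2 := pow_le_pow_left₀ (by linarith) (by linarith) 2
      _ = (p : ℝ) ^ (2 : ℝ) * 1 := by norm_num
      _ ≤ (p : ℝ) ^ (42 / 17 : ℝ) * l ^ (10 / 17 : ℝ) := by
          gcongr
          · linarith
          · norm_num
          · exact Real.one_le_rpow hl1 (by norm_num)
  have h3 : ((p : ℝ) - 1) * Y ≤ D ^ (1 / 17 : ℝ) * ((p : ℝ) ^ (42 / 17 : ℝ) * l ^ (10 / 17 : ℝ)) := by
    calc ((p : ℝ) - 1) * Y ≤ p * (D ^ (1 / 17 : ℝ) * (p : ℝ) ^ (25 / 17 : ℝ) * l ^ (10 / 17 : ℝ)) :=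
          mul_le_mul (by linarith) hYle hY0 hp0.le
      _ = D ^ (1 / 17 : ℝ) * (((p : ℝ) ^ (1 : ℝ) * (p : ℝ) ^ (25 / 17 : ℝ)) * l ^ (10 / 17 : ℝ)) := by
          rw [Real.rpow_one]; ring
      _ = _ := by rw [← Real.rpow_add hp0]; norm_num
  linarith

end Energy

/-! ### The fourth moment of the exponential sums -/

section FourthMoment

open Finset

lemma ofReal_norm_sq_sum_mul_addChar {n : ℕ} [NeZero n] (ψ : AddChar (ZMod n) ℂ)
    (I : ZMod n → ℝ) (z : ZMod n) :
    ((‖∑ x, (I x : ℂ) * ψ (z * x)‖ ^ 2 : ℝ) : ℂ) = ∑ s, (autocorr I s : ℂ) * ψ (z * s) := by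
  have h1 : ((‖∑ x, (I x : ℂ) * ψ (z * x)‖ ^ 2 : ℝ) : ℂ) =
      (∑ x, (I x : ℂ) * ψ (z * x)) * ∑ y, (I y : ℂ) * ψ (-(z * y)) := by
    push_cast
    rw [← Complex.mul_conj', map_sum]
    congr 1
    refine Finset.sum_congr rfl fun y _ => ?_
    rw [map_mul, Complex.conj_ofReal, AddChar.map_neg_eq_conj]
  rw [h1, mul_comm, Finset.sum_mul_sum]
  simp only [autocorr, Complex.ofReal_sum, Complex.ofReal_mul, Finset.sum_mul]
  rw [Finset.sum_comm (s := univ) (t := univ) (f := fun s y => (I y : ℂ) * I (y + s) * ψ (z * s))]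
  refine Finset.sum_congr rfl fun y _ => ?_
  rw [← Equiv.sum_comp (Equiv.addLeft y)]
  refine Finset.sum_congr rfl fun s _ => ?_
  have : ψ (z * s) = ψ (-(z * y)) * ψ (z * (y + s)) := by
    rw [← AddChar.map_add_eq_mul]; congr 1; ring
  rw [this]
  simp only [Equiv.coe_addLeft]
  ring

/-- Parseval's identity on `ZMod n`. -/
lemma sum_norm_sq_sum_mul_stdAddChar {n : ℕ} [NeZero n] (h : ZMod n → ℝ) :
    ∑ z : ZMod n, ‖∑ s, (h s : ℂ) * ZMod.stdAddChar (z * s)‖ ^ 2 = n * ∑ s, h s ^ 2 := by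
  have h1 : ((∑ z : ZMod n, ‖∑ s, (h s : ℂ) * ZMod.stdAddChar (z * s)‖ ^ 2 : ℝ) : ℂ) =
      ((n * ∑ s, h s ^ 2 : ℝ) : ℂ) := by
    rw [Complex.ofReal_sum, Finset.sum_congr rfl fun z _ =>
      ofReal_norm_sq_sum_mul_addChar ZMod.stdAddChar h z, Finset.sum_comm]
    simp only [← Finset.mul_sum, AddChar.sum_mulShift _ (ZMod.isPrimitive_stdAddChar n)]
    rw [Finset.sum_eq_single 0]
    · simp [autocorr, sq, mul_comm]
    · intro s _ hs; simp [hs]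
    · simp
  exact_mod_cast h1

/-- The fourth moment of the Fourier transform is the additive energy. -/
lemma sum_norm_pow_four_eq {n : ℕ} [NeZero n] (I : ZMod n → ℝ) :
    ∑ z : ZMod n, ‖∑ x, (I x : ℂ) * ZMod.stdAddChar (z * x)‖ ^ 4 =
      n * ∑ s, autocorr I s ^ 2 := by
  rw [← sum_norm_sq_sum_mul_stdAddChar]
  refine Finset.sum_congr rfl fun z _ => ?_
  rw [← ofReal_norm_sq_sum_mul_addChar, Complex.norm_real, Real.norm_of_nonneg (by positivity),
    ← pow_mul]

variable {p : ℕ} [Fact p.Prime]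

/-- The exponential sum `∑ e(z m ^ p / p ^ 2)` over the nonzero residues `m` modulo `p`. -/
noncomputable def powSum (p : ℕ) [Fact p.Prime] (z : ZMod (p ^ 2)) : ℂ :=
  ∑ m ∈ univ.erase (0 : ZMod p), ZMod.stdAddChar (z * teichSq m)

lemma powSum_eq (z : ZMod (p ^ 2)) :
    powSum p z = ∑ x, (powInd p x : ℂ) * ZMod.stdAddChar (z * x) := by
  refine Complex.ext ?_ ?_
  · have := sum_powInd_mul (p := p) fun x => (ZMod.stdAddChar (z * x)).re
    simp only [powSum, Complex.re_sum, Complex.re_ofReal_mul]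
    exact this.symm
  · have := sum_powInd_mul (p := p) fun x => (ZMod.stdAddChar (z * x)).im
    simp only [powSum, Complex.im_sum, Complex.im_ofReal_mul]
    exact this.symm

lemma powSum_teichSq_mul {m : ZMod p} (hm : m ≠ 0) (z : ZMod (p ^ 2)) :
    powSum p (teichSq m * z) = powSum p z := by
  unfold powSum
  refine Finset.sum_bij' (fun k _ => m * k) (fun k _ => m⁻¹ * k) ?_ ?_ ?_ ?_ ?_
  · intro k hk; simpa [hm] using hk
  · intro k hk; simpa [hm] using hk
  · intro k _; simp [hm]
  · intro k _; simp [hm]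
  · intro k _
    rw [teichSq_mul]; congr 1; ring

/-- The fourth moment over the frequencies with a given nonzero residue modulo `p`: these represent
all cosets of the `p`-th powers, on which the exponential sum is constant. -/
lemma sum_norm_powSum_pow_four_le {a : ZMod (p ^ 2)} (ha : redP a ≠ 0) :
    ∑ b : ZMod p, ‖powSum p (a + mulP b)‖ ^ 4 ≤
      2 * p * ∑ s, autocorr (powInd p) s ^ 2 := by
  classical
  have hp2 : (2 : ℝ) ≤ p := by exact_mod_cast (Fact.out : p.Prime).two_le
  have h1 : ((p : ℝ) - 1) * ∑ b : ZMod p, ‖powSum p (a + mulP b)‖ ^ 4 ≤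
      ∑ z, ‖powSum p z‖ ^ 4 := by
    have h2 : ((p : ℝ) - 1) * ∑ b : ZMod p, ‖powSum p (a + mulP b)‖ ^ 4 =
        ∑ q ∈ univ.erase (0 : ZMod p) ×ˢ univ, ‖powSum p (teichSq q.1 * (a + mulP q.2))‖ ^ 4 := by
      rw [Finset.sum_product, ← card_erase_zero, ← nsmul_eq_mul, ← Finset.sum_const]
      refine Finset.sum_congr rfl fun m hm => Finset.sum_congr rfl fun b _ => ?_
      rw [powSum_teichSq_mul (ne_of_mem_erase hm)]
    rw [h2, ← Finset.sum_image (f := fun z => ‖powSum p z‖ ^ 4)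
      (g := fun q : ZMod p × ZMod p => teichSq q.1 * (a + mulP q.2))]
    · exact Finset.sum_le_sum_of_subset_of_nonneg (Finset.subset_univ _)
        fun _ _ _ => by positivity
    · rintro ⟨m, b⟩ h ⟨m', b'⟩ _ he
      have hm0 : m ≠ 0 := by simpa using h
      dsimp only at he
      have hm : m = m' := by
        have := congrArg redP he
        simp only [map_mul, map_add, redP_teichSq, redP_mulP, add_zero] at this
        exact mul_right_cancel₀ ha this
      subst hm
      rw [mul_add, mul_add, add_right_inj, mul_mulP, mul_mulP, redP_teichSq] at he
      exact Prod.ext rfl (mul_left_cancel₀ hm0 (mulP_injective he))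
  have h3 : ∑ z, ‖powSum p z‖ ^ 4 = (p : ℝ) ^ 2 * ∑ s, autocorr (powInd p) s ^ 2 := by
    simp only [powSum_eq]
    rw [sum_norm_pow_four_eq]; push_cast; rfl
  rw [h3] at h1
  have hS : 0 ≤ ∑ b : ZMod p, ‖powSum p (a + mulP b)‖ ^ 4 :=
    Finset.sum_nonneg fun _ _ => by positivity
  have h4 : (p : ℝ) * ∑ b : ZMod p, ‖powSum p (a + mulP b)‖ ^ 4 ≤
      p * (2 * p * ∑ s, autocorr (powInd p) s ^ 2) := by nlinarith
  exact le_of_mul_le_mul_left h4 (by linarith)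

end FourthMoment

/-! ### Completion of incomplete sums -/

section Completion

open Finset

variable {p : ℕ} [Fact p.Prime]

lemma stdAddChar_mulP (x : ZMod p) :
    (ZMod.stdAddChar (mulP x) : ℂ) = ZMod.stdAddChar x := by
  obtain ⟨n, rfl⟩ := exists_intCast_eq x
  have hp : (p : ℂ) ≠ 0 := by exact_mod_cast (Fact.out : p.Prime).ne_zero
  have h := ZMod.stdAddChar_coe (N := p ^ 2) ((p : ℤ) * n)
  rw [mulP_intCast, ZMod.stdAddChar_coe]
  push_cast at h
  rw [h]
  congr 1
  field_simp

/-- The Fourier transform of an interval of `N` consecutive integers starting at `M`. -/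
noncomputable def intervalSum (M N : ℕ) (b : ZMod p) : ℂ :=
  ∑ i ∈ range N, ZMod.stdAddChar (-(b * ((M + i : ℕ) : ZMod p)))

/-- Completion of the incomplete sum. -/
lemma sum_intervalSum_mul_powSum (a : ZMod (p ^ 2)) (M N : ℕ) :
    ∑ b : ZMod p, intervalSum M N b * powSum p (a + mulP b) =
      p * ∑ i ∈ range N, if ((M + i : ℕ) : ZMod p) = 0 then (0 : ℂ) else
        ZMod.stdAddChar (a * teichSq ((M + i : ℕ) : ZMod p)) := by
  classical
  unfold intervalSum powSum
  simp only [Finset.sum_mul]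
  rw [Finset.sum_comm, Finset.mul_sum]
  refine Finset.sum_congr rfl fun i _ => ?_
  set y : ZMod p := ((M + i : ℕ) : ZMod p) with hy
  have h1 : ∀ (b m : ZMod p), (ZMod.stdAddChar (-(b * y)) : ℂ) *
      ZMod.stdAddChar ((a + mulP b) * teichSq m) =
      ZMod.stdAddChar (a * teichSq m) * ZMod.stdAddChar (b * (m - y)) := by
    intro b m
    have h2 : (a + mulP b) * teichSq m = a * teichSq m + mulP (m * b) := by
      rw [add_mul, mul_comm (mulP b), mul_mulP, redP_teichSq]
    rw [h2, AddChar.map_add_eq_mul, stdAddChar_mulP, mul_left_comm, ← AddChar.map_add_eq_mul]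
    congr 2; ring
  simp only [Finset.mul_sum, h1]
  rw [Finset.sum_comm]
  simp only [← Finset.mul_sum, AddChar.sum_mulShift _ (ZMod.isPrimitive_stdAddChar p), sub_eq_zero,
    ZMod.card]
  split_ifs with h0
  · refine (Finset.sum_eq_zero fun m hm => ?_).trans (mul_zero _).symm
    rw [h0, if_neg (ne_of_mem_erase hm)]; simp
  · rw [Finset.sum_eq_single y]
    · simp [mul_comm]
    · intro m _ hm; simp [hm]
    · intro h; simp at h; exact absurd h h0

lemma norm_stdAddChar_sub_one_ge (b : ZMod p) :
    4 * (b.valMinAbs.natAbs : ℝ) / p ≤ ‖(ZMod.stdAddChar b : ℂ) - 1‖ := by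
  have hp : (0 : ℝ) < p := by exact_mod_cast (Fact.out : p.Prime).pos
  set v := b.valMinAbs with hv
  have h1 : (ZMod.stdAddChar b : ℂ) = Complex.exp (Complex.I * ((2 * Real.pi * v / p : ℝ) : ℂ)) := by
    conv_lhs => rw [← ZMod.coe_valMinAbs b]
    rw [ZMod.stdAddChar_coe]
    congr 1
    push_cast; ring
  have habs : (v.natAbs : ℝ) = |(v : ℝ)| := by
    rw [Nat.cast_natAbs, Int.cast_abs]
  have h2 : (v.natAbs : ℝ) ≤ p / 2 := by
    have := ZMod.natAbs_valMinAbs_le b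
    calc (v.natAbs : ℝ) ≤ ((p / 2 : ℕ) : ℝ) := by exact_mod_cast this
      _ ≤ _ := Nat.cast_div_le
  have hx : |Real.pi * v / p| = Real.pi * |(v : ℝ)| / p := by
    rw [abs_div, abs_mul, abs_of_pos Real.pi_pos, abs_of_pos hp]
  have h3 : |Real.pi * v / p| ≤ Real.pi / 2 := by
    rw [hx, div_le_iff₀ hp]
    rw [habs] at h2
    nlinarith [Real.pi_pos]
  rw [h1, Complex.norm_exp_I_mul_ofReal_sub_one, norm_mul, Real.norm_eq_abs, Real.norm_eq_abs,
    show 2 * Real.pi * (v : ℝ) / p / 2 = Real.pi * v / p by ring]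
  have h4 := Real.mul_abs_le_abs_sin h3
  rw [hx] at h4
  have h5 : 2 / Real.pi * (Real.pi * |(v : ℝ)| / p) = 2 * |(v : ℝ)| / p := by
    field_simp
  rw [h5] at h4
  rw [habs, abs_of_pos (by norm_num : (0 : ℝ) < 2)]
  calc 4 * |(v : ℝ)| / p = 2 * (2 * |(v : ℝ)| / p) := by ring
    _ ≤ _ := by gcongr

/-- The decay of the Fourier transform of an interval. -/
lemma norm_intervalSum_le (M N : ℕ) (b : ZMod p) :
    ‖intervalSum M N b‖ ≤ 2 * N / ((b.valMinAbs.natAbs * N / p : ℕ) + 1 : ℝ) := by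
  have hp : (0 : ℝ) < p := by exact_mod_cast (Fact.out : p.Prime).pos
  set j := b.valMinAbs.natAbs * N / p with hj
  have htriv : ‖intervalSum M N b‖ ≤ N := by
    refine (norm_sum_le _ _).trans (le_of_eq ?_)
    simp [AddChar.norm_apply]
  have hj0 : (0 : ℝ) < (j : ℝ) + 1 := by positivity
  rw [le_div_iff₀ hj0]
  -- the trivial bound for `j = 0`, and otherwise the bound of the geometric series by Jordan's
  -- inequality
  rcases Nat.eq_zero_or_pos j with h0 | h0
  · rw [h0]; push_cast; nlinarith [norm_nonneg (intervalSum M N b)]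
  · set v := b.valMinAbs.natAbs with hv
    have hjp : j * p ≤ v * N := Nat.div_mul_le_self _ _
    have hv0 : 0 < v := by
      by_contra h
      have : v = 0 := by omega
      rw [this, zero_mul, Nat.zero_div] at hj
      omega
    have hvn : (-b).valMinAbs.natAbs = v := ZMod.natAbs_valMinAbs_neg b
    have hω := norm_stdAddChar_sub_one_ge (-b)
    rw [hvn] at hω
    have hωpos : 0 < ‖(ZMod.stdAddChar (-b) : ℂ) - 1‖ := lt_of_lt_of_le (by positivity) hω
    have hne : (ZMod.stdAddChar (-b) : ℂ) ≠ 1 := by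
      intro h; rw [h, sub_self, norm_zero] at hωpos; exact lt_irrefl _ hωpos
    have hgeom : intervalSum M N b = ZMod.stdAddChar (-(b * (M : ZMod p))) *
        ∑ i ∈ range N, (ZMod.stdAddChar (-b) : ℂ) ^ i := by
      rw [intervalSum, Finset.mul_sum]
      refine Finset.sum_congr rfl fun i _ => ?_
      rw [← AddChar.map_nsmul_eq_pow, ← AddChar.map_add_eq_mul]
      congr 1
      rw [nsmul_eq_mul]; push_cast; ring
    have h1 : ‖intervalSum M N b‖ * (4 * (v : ℝ) / p) ≤ 2 := by
      calc ‖intervalSum M N b‖ * (4 * (v : ℝ) / p)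
          ≤ ‖intervalSum M N b‖ * ‖(ZMod.stdAddChar (-b) : ℂ) - 1‖ := by gcongr
        _ = ‖(ZMod.stdAddChar (-b) : ℂ) ^ N - 1‖ := by
            rw [hgeom, norm_mul, AddChar.norm_apply, one_mul, geom_sum_eq hne, norm_div,
              div_mul_cancel₀ _ hωpos.ne']
        _ ≤ 2 := by
            refine (norm_sub_le _ _).trans (le_of_eq ?_)
            rw [norm_pow, AddChar.norm_apply, one_pow, norm_one]; norm_num
    have h2 : ‖intervalSum M N b‖ * (2 * v) ≤ p := by
      have e : ‖intervalSum M N b‖ * (4 * (v : ℝ) / p) * p = ‖intervalSum M N b‖ * (4 * v) := by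
        field_simp
      have := mul_le_mul_of_nonneg_right h1 hp.le
      rw [e] at this
      linarith
    have hjp' : (j : ℝ) * p ≤ v * N := by exact_mod_cast hjp
    have hv0' : (0 : ℝ) < v := by exact_mod_cast hv0
    have h3 : v * (‖intervalSum M N b‖ * (j + 1)) ≤ v * (2 * N) := by
      have hj1 : (1 : ℝ) ≤ j := by exact_mod_cast h0
      calc v * (‖intervalSum M N b‖ * (j + 1)) ≤ v * (‖intervalSum M N b‖ * (2 * j)) := by
            gcongr; linarith
        _ = ‖intervalSum M N b‖ * (2 * v) * j := by ring
        _ ≤ p * j := by gcongr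
        _ ≤ v * N := by linarith
        _ ≤ v * (2 * N) := by nlinarith [(Nat.cast_nonneg N : (0 : ℝ) ≤ N)]
    exact le_of_mul_le_mul_left h3 hv0'

/-- Each value of `⌊n N / p⌋` is taken by at most `3 p / N` integers `n`. -/
lemma card_filter_mul_div_eq_le {N : ℕ} (hN : 0 < N) (hNp : N ≤ p) (j : ℕ) :
    (#{n ∈ range p | n * N / p = j} : ℝ) ≤ 3 * (p / N) := by
  have hp0 : 0 < p := (Fact.out : p.Prime).pos
  have hsub : {n ∈ range p | n * N / p = j} ⊆ Ico (j * p / N) (j * p / N + (p / N + 2)) := by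
    intro n hn
    obtain ⟨_, hnj⟩ := mem_filter.1 hn
    have h1 : j * p ≤ n * N := hnj ▸ Nat.div_mul_le_self _ _
    have h2 : n * N < p * (j + 1) := by rw [← hnj]; exact Nat.lt_mul_div_succ _ hp0
    have h3 : j * p < N * (j * p / N + 1) := Nat.lt_mul_div_succ _ hN
    have h4 : p < N * (p / N + 1) := Nat.lt_mul_div_succ _ hN
    rw [mem_Ico]
    refine ⟨Nat.div_le_of_le_mul (by linarith), ?_⟩
    refine Nat.lt_of_mul_lt_mul_left (a := N) ?_
    nlinarith
  have h5 := card_le_card hsub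
  rw [Nat.card_Ico, Nat.add_sub_cancel_left] at h5
  have hN' : (0 : ℝ) < N := by exact_mod_cast hN
  have h6 : (1 : ℝ) ≤ p / N := by rw [le_div_iff₀ hN', one_mul]; exact_mod_cast hNp
  calc (#{n ∈ range p | n * N / p = j} : ℝ) ≤ ((p / N + 2 : ℕ) : ℝ) := by exact_mod_cast h5
    _ ≤ p / N + 2 := by push_cast; gcongr; exact Nat.cast_div_le
    _ ≤ _ := by linarith

lemma sum_natAbs_valMinAbs_le (F : ℕ → ℝ) (hF : ∀ n, 0 ≤ F n) :
    ∑ b : ZMod p, F b.valMinAbs.natAbs ≤ 2 * ∑ n ∈ range p, F n := by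
  classical
  have hmaps : ∀ b ∈ (univ : Finset (ZMod p)), b.valMinAbs.natAbs ∈ range p := fun b _ => by
    have h1 := ZMod.natAbs_valMinAbs_le b
    have h2 := (Fact.out : p.Prime).two_le
    rw [mem_range]; omega
  rw [← Finset.sum_fiberwise_of_maps_to hmaps, Finset.mul_sum]
  refine Finset.sum_le_sum fun n _ => ?_
  rw [Finset.sum_congr rfl (g := fun _ => F n) (by
    intro b hb; rw [(mem_filter.1 hb).2]), Finset.sum_const, nsmul_eq_mul]
  refine mul_le_mul_of_nonneg_right ?_ (hF n)
  have hsub : ({b : ZMod p | b.valMinAbs.natAbs = n} : Finset (ZMod p)) ⊆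
      {(n : ZMod p), -(n : ZMod p)} := by
    intro b hb
    have hb' : b.valMinAbs.natAbs = n := by simpa using hb
    rw [mem_insert, mem_singleton]
    have e := ZMod.coe_valMinAbs b
    rcases Int.natAbs_eq b.valMinAbs with h | h
    · left; rw [h, hb'] at e; rw [← e]; simp
    · right; rw [h, hb'] at e; rw [← e]; simp
  exact_mod_cast (card_le_card hsub).trans card_le_two

/-- The `4/3`-norm of the Fourier transform of an interval. -/
lemma exists_sum_norm_intervalSum_rpow_le : ∃ Z : ℝ, 0 ≤ Z ∧ ∀ (p : ℕ) [Fact p.Prime] (M N : ℕ),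
    0 < N → N ≤ p → ∑ b : ZMod p, ‖intervalSum M N b‖ ^ (4 / 3 : ℝ) ≤
      (2 * N : ℝ) ^ (4 / 3 : ℝ) * (Z * (p / N)) := by
  have hsum : Summable fun n : ℕ => (((n : ℝ) + 1) ^ (4 / 3 : ℝ))⁻¹ := by
    have h := (Real.summable_nat_rpow_inv (p := 4 / 3)).2 (by norm_num)
    have h2 := (summable_nat_add_iff 1).2 h
    simpa using h2
  have hpos : ∀ n : ℕ, 0 ≤ (((n : ℝ) + 1) ^ (4 / 3 : ℝ))⁻¹ := fun n => by positivity
  set Z := ∑' n : ℕ, (((n : ℝ) + 1) ^ (4 / 3 : ℝ))⁻¹ with hZ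
  refine ⟨6 * Z, by have : 0 ≤ Z := tsum_nonneg hpos; positivity, ?_⟩
  intro p _ M N hN hNp
  have hp0 : 0 < p := (Fact.out : p.Prime).pos
  set F : ℕ → ℝ := fun n => (((n * N / p : ℕ) + 1 : ℝ) ^ (4 / 3 : ℝ))⁻¹ with hF
  have h1 : ∀ b : ZMod p, ‖intervalSum M N b‖ ^ (4 / 3 : ℝ) ≤
      (2 * N : ℝ) ^ (4 / 3 : ℝ) * F b.valMinAbs.natAbs := by
    intro b
    refine (Real.rpow_le_rpow (norm_nonneg _) (norm_intervalSum_le M N b)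
      (by norm_num)).trans (le_of_eq ?_)
    rw [Real.div_rpow (by positivity) (by positivity), div_eq_mul_inv]
  have h2 : ∑ n ∈ range p, F n ≤ 3 * (p / N) * Z := by
    rw [← Finset.sum_fiberwise_of_maps_to (g := fun n => n * N / p) (t := range (N + 1))]
    · calc ∑ j ∈ range (N + 1), ∑ n ∈ range p with n * N / p = j, F n
          = ∑ j ∈ range (N + 1), (#{n ∈ range p | n * N / p = j} : ℝ) *
              (((j : ℝ) + 1) ^ (4 / 3 : ℝ))⁻¹ := by
            refine Finset.sum_congr rfl fun j _ => ?_
            rw [← nsmul_eq_mul, ← Finset.sum_const]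
            refine Finset.sum_congr rfl fun n hn => ?_
            simp only [hF, (mem_filter.1 hn).2]
        _ ≤ ∑ j ∈ range (N + 1), 3 * ((p : ℝ) / N) * (((j : ℝ) + 1) ^ (4 / 3 : ℝ))⁻¹ :=
            Finset.sum_le_sum fun j _ =>
              mul_le_mul_of_nonneg_right (card_filter_mul_div_eq_le hN hNp j) (hpos j)
        _ ≤ _ := by
            rw [← Finset.mul_sum]
            exact mul_le_mul_of_nonneg_left (hsum.sum_le_tsum _ fun j _ => hpos j) (by positivity)
    · intro n hn
      rw [mem_range] at hn ⊢
      have : n * N / p ≤ N := Nat.div_le_of_le_mul (by nlinarith)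
      omega
  calc ∑ b : ZMod p, ‖intervalSum M N b‖ ^ (4 / 3 : ℝ)
      ≤ ∑ b : ZMod p, (2 * N : ℝ) ^ (4 / 3 : ℝ) * F b.valMinAbs.natAbs :=
        Finset.sum_le_sum fun b _ => h1 b
    _ ≤ (2 * N : ℝ) ^ (4 / 3 : ℝ) * (2 * (3 * (p / N) * Z)) := by
        rw [← Finset.mul_sum]
        refine mul_le_mul_of_nonneg_left ?_ (by positivity)
        refine (sum_natAbs_valMinAbs_le F fun n => by positivity).trans ?_
        linarith
    _ = _ := by ring

/-- The bound for an incomplete sum by the additive energy, by completion and Hölder's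
inequality. -/
lemma exists_norm_sum_stdAddChar_le : ∃ C : ℝ, 0 ≤ C ∧ ∀ (p : ℕ) [Fact p.Prime] (a : ZMod (p ^ 2))
    (M N : ℕ), redP a ≠ 0 → 0 < N → N ≤ p →
    ‖∑ i ∈ range N, if ((M + i : ℕ) : ZMod p) = 0 then (0 : ℂ) else
        ZMod.stdAddChar (a * teichSq ((M + i : ℕ) : ZMod p))‖ ≤
      C * (N : ℝ) ^ (1 / 4 : ℝ) * (∑ s, autocorr (powInd p) s ^ 2) ^ (1 / 4 : ℝ) := by
  obtain ⟨Z, hZ0, hZ⟩ := exists_sum_norm_intervalSum_rpow_le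
  refine ⟨2 * Z ^ (3 / 4 : ℝ) * 2 ^ (1 / 4 : ℝ), by positivity, ?_⟩
  intro p _ a M N ha hN hNp
  have hp0 : (0 : ℝ) < p := by exact_mod_cast (Fact.out : p.Prime).pos
  have hN0 : (0 : ℝ) < N := by exact_mod_cast hN
  set T := ∑ i ∈ range N, if ((M + i : ℕ) : ZMod p) = 0 then (0 : ℂ) else
        ZMod.stdAddChar (a * teichSq ((M + i : ℕ) : ZMod p)) with hT
  set E := ∑ s, autocorr (powInd p) s ^ 2 with hE
  have hE0 : 0 ≤ E := Finset.sum_nonneg fun _ _ => sq_nonneg _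
  have h1 : (p : ℝ) * ‖T‖ ≤ ∑ b : ZMod p, ‖intervalSum M N b‖ * ‖powSum p (a + mulP b)‖ := by
    have h2 := sum_intervalSum_mul_powSum a M N
    have h3 : (p : ℝ) * ‖T‖ = ‖(p : ℂ) * T‖ := by rw [norm_mul, Complex.norm_natCast]
    rw [h3, hT, ← h2]
    refine (norm_sum_le _ _).trans (le_of_eq ?_)
    simp only [norm_mul]
  have hconj : (4 / 3 : ℝ).HolderConjugate 4 := by
    rw [Real.holderConjugate_iff]; norm_num
  have h4 := Real.inner_le_Lp_mul_Lq univ (fun b : ZMod p => ‖intervalSum M N b‖)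
    (fun b => ‖powSum p (a + mulP b)‖) hconj
  simp only [abs_norm] at h4
  have h5 : (∑ b : ZMod p, ‖intervalSum M N b‖ ^ (4 / 3 : ℝ)) ^ (1 / (4 / 3) : ℝ) ≤
      2 * N * (Z ^ (3 / 4 : ℝ) * ((p : ℝ) ^ (3 / 4 : ℝ) / (N : ℝ) ^ (3 / 4 : ℝ))) := by
    refine (Real.rpow_le_rpow (Finset.sum_nonneg fun _ _ => by positivity) (hZ p M N hN hNp)
      (by norm_num)).trans (le_of_eq ?_)
    rw [Real.mul_rpow (by positivity) (by positivity), ← Real.rpow_mul (by positivity),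
      Real.mul_rpow hZ0 (by positivity), Real.div_rpow hp0.le hN0.le]
    norm_num
  have h6 : (∑ b : ZMod p, ‖powSum p (a + mulP b)‖ ^ (4 : ℝ)) ^ (1 / 4 : ℝ) ≤
      2 ^ (1 / 4 : ℝ) * (p : ℝ) ^ (1 / 4 : ℝ) * E ^ (1 / 4 : ℝ) := by
    have h7 := sum_norm_powSum_pow_four_le ha
    have h8 : ∑ b : ZMod p, ‖powSum p (a + mulP b)‖ ^ (4 : ℝ) ≤ 2 * p * E := by
      refine le_trans (le_of_eq (Finset.sum_congr rfl fun b _ => ?_)) h7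
      exact_mod_cast Real.rpow_natCast _ 4
    refine (Real.rpow_le_rpow (Finset.sum_nonneg fun _ _ => by positivity) h8
      (by norm_num)).trans (le_of_eq ?_)
    rw [Real.mul_rpow (by positivity) hE0, Real.mul_rpow (by norm_num) hp0.le]
  have h9 : (p : ℝ) * ‖T‖ ≤ (2 * N * (Z ^ (3 / 4 : ℝ) *
      ((p : ℝ) ^ (3 / 4 : ℝ) / (N : ℝ) ^ (3 / 4 : ℝ)))) *
      (2 ^ (1 / 4 : ℝ) * (p : ℝ) ^ (1 / 4 : ℝ) * E ^ (1 / 4 : ℝ)) := by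
    refine h1.trans (h4.trans ?_)
    gcongr
  have h10 : (p : ℝ) ^ (3 / 4 : ℝ) * (p : ℝ) ^ (1 / 4 : ℝ) = p := by
    rw [← Real.rpow_add hp0]; norm_num
  have h11 : (N : ℝ) / (N : ℝ) ^ (3 / 4 : ℝ) = (N : ℝ) ^ (1 / 4 : ℝ) := by
    rw [div_eq_iff (by positivity), ← Real.rpow_add hN0]; norm_num
  refine le_of_mul_le_mul_left (h9.trans (le_of_eq ?_)) hp0
  rw [← h11]
  conv_rhs => rw [← h10]
  ring

end Completion

/-! ### Bounds for Heilbronn sums -/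

section Heilbronn

open Finset

variable {p : ℕ} [Fact p.Prime]

lemma addExp_eq_stdAddChar (a : ℤ) (n : ℕ) :
    addExp ((a : ℝ) * (n : ℝ) ^ p / (p : ℝ) ^ 2) =
      ZMod.stdAddChar ((a : ZMod (p ^ 2)) * teichSq (n : ZMod p)) := by
  have h := ZMod.stdAddChar_coe (N := p ^ 2) (a * (n : ℤ) ^ p)
  rw [teichSq_natCast]
  push_cast at h
  rw [h, addExp]
  congr 1
  push_cast
  ring

omit [Fact p.Prime] in
lemma norm_addExp (x : ℝ) : ‖addExp x‖ = 1 := by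
  rw [addExp, show 2 * (Real.pi : ℂ) * Complex.I * (x : ℂ) =
    ((2 * Real.pi * x : ℝ) : ℂ) * Complex.I by push_cast; ring]
  exact Complex.norm_exp_ofReal_mul_I _

/-- The last term, and the at most one term with `p ∣ n` among the others, cost at most `2`. -/
lemma norm_incompleteHeilbronnSum_le (a : ℤ) (M : ℕ) {N : ℕ} (hNp : N ≤ p) :
    ‖incompleteHeilbronnSum p a M N‖ ≤
      ‖∑ i ∈ range N, if ((M + i : ℕ) : ZMod p) = 0 then (0 : ℂ) else
        ZMod.stdAddChar ((a : ZMod (p ^ 2)) * teichSq ((M + i : ℕ) : ZMod p))‖ + 2 := by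
  set S : Finset ℕ := {i ∈ range N | ((M + i : ℕ) : ZMod p) = 0} with hS
  have hcard : #S ≤ 1 := by
    rw [Finset.card_le_one]
    intro i hi j hj
    simp only [hS, mem_filter, mem_range, Nat.cast_add] at hi hj
    refine natCast_injOn_lt (p := p) (by omega) (by omega) ?_
    exact add_left_cancel (hi.2.trans hj.2.symm)
  have h1 : incompleteHeilbronnSum p a M N =
      (∑ i ∈ range N, if ((M + i : ℕ) : ZMod p) = 0 then (0 : ℂ) else
        ZMod.stdAddChar ((a : ZMod (p ^ 2)) * teichSq ((M + i : ℕ) : ZMod p))) +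
      #S + addExp ((a : ℝ) * ((M + N : ℕ) : ℝ) ^ p / (p : ℝ) ^ 2) := by
    rw [incompleteHeilbronnSum, ← Finset.Ico_add_one_right_eq_Icc, Finset.sum_Ico_eq_sum_range,
      show M + N + 1 - M = N + 1 by omega, Finset.sum_range_succ, hS, Finset.card_filter]
    congr 1
    push_cast
    rw [← Finset.sum_add_distrib]
    refine Finset.sum_congr rfl fun i _ => ?_
    rw [← Nat.cast_add, addExp_eq_stdAddChar, ← Nat.cast_add]
    split_ifs with h
    · rw [h, teichSq_zero, mul_zero, AddChar.map_zero_eq_one, zero_add]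
    · rw [add_zero]
  rw [h1]
  refine (norm_add₃_le).trans ?_
  rw [norm_addExp, Complex.norm_natCast, add_assoc]
  have : (#S : ℝ) ≤ 1 := by exact_mod_cast hcard
  linarith

end Heilbronn

theorem mainTheorem2 :
    (∃ C : ℝ, 0 < C ∧ ∀ (p : ℕ) (a : ℤ) (M N : ℕ), p.Prime → ¬ a ≡ 0 [ZMOD (p : ℤ)] →
      0 < M → 0 < N → N ≤ p →
        ‖incompleteHeilbronnSum p a M N‖ ≤
          C * (p : ℝ) ^ (21 / 34 : ℝ) * (N : ℝ) ^ (1 / 4 : ℝ) *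
            Real.logb 2 (p : ℝ) ^ (5 / 34 : ℝ)) ∧
    (∃ C : ℝ, 0 < C ∧ ∀ (p : ℕ) (a : ℤ), p.Prime → ¬ a ≡ 0 [ZMOD (p : ℤ)] →
        ‖heilbronnSum p a‖ ≤
          C * (p : ℝ) ^ (59 / 68 : ℝ) * Real.logb 2 (p : ℝ) ^ (5 / 34 : ℝ)) := by
  have hmain : ∃ C : ℝ, 0 < C ∧ ∀ (p : ℕ) (a : ℤ) (M N : ℕ), p.Prime →
      ¬ a ≡ 0 [ZMOD (p : ℤ)] → 0 < M → 0 < N → N ≤ p →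
        ‖incompleteHeilbronnSum p a M N‖ ≤
          C * (p : ℝ) ^ (21 / 34 : ℝ) * (N : ℝ) ^ (1 / 4 : ℝ) *
            Real.logb 2 (p : ℝ) ^ (5 / 34 : ℝ) := by
    obtain ⟨C₁, hC₁, hE⟩ := exists_energy_le
    obtain ⟨C₂, hC₂, hT⟩ := exists_norm_sum_stdAddChar_le
    refine ⟨C₂ * C₁ ^ (1 / 4 : ℝ) + 9, by positivity, ?_⟩
    intro p a M N hp ha _ hN hNp
    have : Fact p.Prime := ⟨hp⟩
    have hp2 : (2 : ℝ) ≤ p := by exact_mod_cast hp.two_le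
    have hp0 : (0 : ℝ) < p := by linarith
    have hN1 : (1 : ℝ) ≤ N := by exact_mod_cast hN
    have hl : 1 ≤ Real.logb 2 (p : ℝ) := by
      rw [Real.le_logb_iff_rpow_le (by norm_num) hp0]; simpa using hp2
    set B : ℝ := (p : ℝ) ^ (21 / 34 : ℝ) * (N : ℝ) ^ (1 / 4 : ℝ) *
      Real.logb 2 (p : ℝ) ^ (5 / 34 : ℝ) with hB
    have hB1 : 1 ≤ B := by
      have h1 := Real.one_le_rpow (by linarith : (1 : ℝ) ≤ p) (by norm_num : (0 : ℝ) ≤ 21 / 34)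
      have h2 := Real.one_le_rpow hN1 (by norm_num : (0 : ℝ) ≤ 1 / 4)
      have h3 := Real.one_le_rpow hl (by norm_num : (0 : ℝ) ≤ 5 / 34)
      exact one_le_mul_of_one_le_of_one_le (one_le_mul_of_one_le_of_one_le h1 h2) h3
    have hC : 0 ≤ C₂ * C₁ ^ (1 / 4 : ℝ) := by positivity
    rw [mul_assoc, mul_assoc, ← mul_assoc ((p : ℝ) ^ (21 / 34 : ℝ)), ← hB]
    rcases lt_or_ge p 8 with hp8 | hp8
    · -- for small `p` the number of terms is bounded
      have h1 : ‖incompleteHeilbronnSum p a M N‖ ≤ 9 := by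
        refine (norm_sum_le _ _).trans ?_
        simp only [norm_addExp, Finset.sum_const, nsmul_eq_mul, mul_one, Nat.card_Icc]
        exact_mod_cast (by omega : M + N + 1 - M ≤ 9)
      nlinarith
    · have ha' : redP ((a : ZMod (p ^ 2))) ≠ 0 := by
        rw [redP_intCast, Ne, ZMod.intCast_zmod_eq_zero_iff_dvd]
        exact fun h => ha (Int.modEq_zero_iff_dvd.2 h)
      have h1 := norm_incompleteHeilbronnSum_le a M hNp
      have h2 := hT p (a : ZMod (p ^ 2)) M N ha' hN hNp
      have h3 := hE p hp8
      have hl0 : 0 ≤ Real.logb 2 (p : ℝ) := by linarith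
      have h4 : (∑ s, autocorr (powInd p) s ^ 2) ^ (1 / 4 : ℝ) ≤ C₁ ^ (1 / 4 : ℝ) *
          (p : ℝ) ^ (21 / 34 : ℝ) * Real.logb 2 (p : ℝ) ^ (5 / 34 : ℝ) := by
        refine (Real.rpow_le_rpow (Finset.sum_nonneg fun _ _ => sq_nonneg _) h3
          (by norm_num)).trans (le_of_eq ?_)
        rw [Real.mul_rpow (by positivity) (by positivity), Real.mul_rpow (by linarith)
          (by positivity), ← Real.rpow_mul hp0.le, ← Real.rpow_mul hl0]
        norm_num
      have h5 : C₂ * (N : ℝ) ^ (1 / 4 : ℝ) * (∑ s, autocorr (powInd p) s ^ 2) ^ (1 / 4 : ℝ) ≤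
          C₂ * C₁ ^ (1 / 4 : ℝ) * B := by
        calc C₂ * (N : ℝ) ^ (1 / 4 : ℝ) * (∑ s, autocorr (powInd p) s ^ 2) ^ (1 / 4 : ℝ)
            ≤ C₂ * (N : ℝ) ^ (1 / 4 : ℝ) * (C₁ ^ (1 / 4 : ℝ) *
              (p : ℝ) ^ (21 / 34 : ℝ) * Real.logb 2 (p : ℝ) ^ (5 / 34 : ℝ)) := by gcongr
          _ = _ := by rw [hB]; ring
      linarith
  refine ⟨hmain, ?_⟩
  obtain ⟨C, hC, h⟩ := hmain
  refine ⟨C, hC, fun p a hp ha => ?_⟩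
  have hp2 := hp.two_le
  have hp0 : (0 : ℝ) < p := by exact_mod_cast hp.pos
  have h1 := h p a 1 (p - 1) hp ha one_pos (by omega) (by omega)
  have h2 : incompleteHeilbronnSum p a 1 (p - 1) = heilbronnSum p a := by
    rw [incompleteHeilbronnSum, heilbronnSum, show 1 + (p - 1) = p by omega]
  rw [h2] at h1
  refine h1.trans ?_
  have hl0 : 0 ≤ Real.logb 2 (p : ℝ) :=
    Real.logb_nonneg (by norm_num) (by exact_mod_cast hp.one_le)
  have h3 : (p : ℝ) ^ (59 / 68 : ℝ) = (p : ℝ) ^ (21 / 34 : ℝ) * (p : ℝ) ^ (1 / 4 : ℝ) := by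
    rw [← Real.rpow_add hp0]; norm_num
  have h4 : ((p - 1 : ℕ) : ℝ) ≤ p := by exact_mod_cast Nat.sub_le p 1
  rw [h3, ← mul_assoc]
  gcongr
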